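/- For a finite group $G$ let $\mu(G)$ be the minimal faithful permutation degree of $G$, i.e. the least $n$ such that $G$ embeds in the symmetric group $\mathrm{Sym}(n)$. Let $\mathcal I$ be the binary icosahedral group, i.e. the subgroup (of order $120$) of the multiplicative group of the real quaternions generated by $\tfrac12(1+i+j+k)$ and $\tfrac12(\varphi+\varphi^{-1}i+j)$, $\varphi=\tfrac{1+\sqrt5}{2}$, and let $\mathcal I\circ\mathcal I=(\mathcal I\times\mathcal I)/\{(z,z): z\in Z(\mathcal I)\}$ be its central product with itself. Let $W(H_4)$ be the Coxeter group of type $H_4$. Then: 1. $\mathcal I\circ\mathcal I$ has a unique minimal normal subgroup, and this subgroup is isomorphic to $C_2$. 2. Every faithful permutation representation of $\mathcal I\circ\mathcal I$ of minimal degree is transitive, and $\mu(\mathcal I\circ\mathcal I)$ is the least index of a core-free subgroup of $\mathcal I\circ\mathcal I$ (a subgroup $L$ with $\bigcap_{g} g^{-1}Lg=1$). 3. $\mu(\mathcal I\circ\mathcal I)=\mu(W(H_4))=120$, and the root system of type $H_4$ (the orbit of the simple roots under the geometric representation of $W(H_4)$) has exactly $120$ elements. -/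

import Mathlib

open scoped Quaternion

/-- The minimal faithful permutation degree `μ(G)`: the least `n` such that `G` embeds in the
symmetric group on `n` points. -/
noncomputable def minimalDegree (G : Type*) [Group G] : ℕ :=
  sInf {n : ℕ | ∃ f : G →* Equiv.Perm (Fin n), Function.Injective f}

/-- `N` is a minimal normal subgroup of `G`: it is minimal among the nontrivial normal
subgroups. -/
def IsMinimalNormal {G : Type*} [Group G] (N : Subgroup G) : Prop :=
  Minimal (fun K : Subgroup G => K.Normal ∧ K ≠ ⊥) N

/-- The binary icosahedral group, as the subgroup of the multiplicative group of the real
quaternions generated by `(1 + i + j + k) / 2` and `(φ + φ⁻¹ i + j) / 2`, where `φ` is the golden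
ratio. -/
noncomputable def binaryIcosahedral : Subgroup ℍ[ℝ]ˣ :=
  Subgroup.closure {u : ℍ[ℝ]ˣ |
    (u : ℍ[ℝ]) = ⟨1 / 2, 1 / 2, 1 / 2, 1 / 2⟩ ∨
    (u : ℍ[ℝ]) = ⟨Real.goldenRatio / 2, Real.goldenRatio⁻¹ / 2, 1 / 2, 0⟩}

/-- The diagonal subgroup `{(z, z) | z ∈ Z(G)}` of the centre of `G × G`. -/
def diagonalCenter (G : Type*) [Group G] : Subgroup (G × G) :=
  (Subgroup.center G).map ((MonoidHom.id G).prod (MonoidHom.id G))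

instance diagonalCenter_normal (G : Type*) [Group G] : (diagonalCenter G).Normal := by
  refine ⟨?_⟩
  rintro _ ⟨z, hz, rfl⟩ ⟨a, b⟩
  refine ⟨z, hz, ?_⟩
  have hz' := Subgroup.mem_center_iff.mp hz
  simp [hz' a, hz' b]

/-- The central product `G ∘ G`: the quotient of `G × G` by the diagonal subgroup of its centre.
(When every element of the centre of `G` squares to `1`, as for the binary icosahedral group, this
is also the quotient by `{(z, z⁻¹) | z ∈ Z(G)}`.) -/
abbrev CentralSquare (G : Type*) [Group G] : Type _ := (G × G) ⧸ diagonalCenter G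

section RootSystem

variable {B : Type*} [Fintype B] [DecidableEq B] (M : CoxeterMatrix B)

/-- The symmetric bilinear form of a Coxeter matrix on the real vector space with basis the simple
roots `α i`, determined by `⟪α i, α j⟫ = - cos (π / M i j)`. (For `M i j = 0`, which encodes `∞`,
this is `- cos 0 = -1`, the usual convention.) -/
noncomputable def coxeterForm : LinearMap.BilinForm ℝ (B → ℝ) :=
  Matrix.toBilin' (Matrix.of fun i j => - Real.cos (Real.pi / (M i j : ℝ)))

/-- The simple root `α i`. -/
def simpleRoot (i : B) : B → ℝ := Pi.single i 1

/-- The reflection `v ↦ v - 2 ⟪α i, v⟫ α i` by which the simple reflection `s i` acts in the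
geometric representation of the Coxeter group. -/
noncomputable def simpleRootReflection (i : B) : Module.End ℝ (B → ℝ) :=
  LinearMap.id - (2 : ℝ) • (coxeterForm M (simpleRoot i)).smulRight (simpleRoot i)

/-- The root system of a Coxeter matrix: the orbit of the simple roots under the group generated by
the simple reflections in the geometric representation. (These are involutions, so the monoid they
generate is that group.) -/
def coxeterRoots : Set (B → ℝ) :=
  {v | ∃ w ∈ Submonoid.closure (Set.range (simpleRootReflection M)), ∃ i, w (simpleRoot i) = v}

end RootSystem

/-! Write I for the binary icosahedral group and z for the class of (-1, 1), the central involution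
of I ∘ I. A commutator argument puts z in every nontrivial normal subgroup, so ⟨z⟩ is the unique
minimal one, and a subgroup is core-free exactly when it avoids z.

A subgroup avoiding z pulls back to some H ≤ I × I without (-1, 1). If H ∩ (I × 1) is trivial, H
embeds in the second factor and |H| ≤ 120. Otherwise H ∩ (I × 1) misses -1 and is normalized by the
first projection of H, which therefore has order at most 20, while H ∩ (1 × I) has order at most 5;
so |H| ≤ 100. Hence every subgroup avoiding z has index at least 14400 / 120 = 120
(`le_index_of_notMem`). A faithful action moves some point by z, and the orbit of that point has at
least 120 elements. The action u ↦ p u q⁻¹ on I attains this bound.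

The bounds 5 and 20 need no classification of subgroups. Elements of I satisfy x² = t x - 1 with t
among nine values in ℤ[φ]; suitable sums over subgroups vanish, and comparing the coefficients of 1
and φ in their traces bounds the number of terms. The traces are read off an explicit list of the
120 elements.

For W(H₄), view I as a root system of unit quaternions. The reflections u ↦ -r u⁻¹ r give an action
on 120 points, faithful by the usual argument on lengths and positive roots (`permRep_injective`).
Its image contains all left and right multiplications, so I ∘ I embeds in W(H₄) and both degrees are
120. The left multiplications also carry the root 1 to every element of I, so there are exactly 120
roots. -/

open scoped goldenRatio

/-! ### An integral model of the binary icosahedral group -/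

/-- The pair `(a, b)` stands for `a + b φ`. -/
abbrev GoldenInt : Type := ℤ × ℤ

/-- The coordinates of a quaternion over `ℤ[φ]`, all multiplied by two. -/
abbrev HalfIcosian : Type := GoldenInt × GoldenInt × GoldenInt × GoldenInt

namespace HalfIcosian

/-- Multiplication in `ℤ[φ]`. -/
def gmul (x y : GoldenInt) : GoldenInt :=
  (x.1 * y.1 + x.2 * y.2, x.1 * y.2 + x.2 * y.1 + x.2 * y.2)

/-- Twice the product, in doubled coordinates. -/
def dmul (x y : HalfIcosian) : HalfIcosian :=
  (gmul x.1 y.1 - gmul x.2.1 y.2.1 - gmul x.2.2.1 y.2.2.1 - gmul x.2.2.2 y.2.2.2,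
   gmul x.1 y.2.1 + gmul x.2.1 y.1 + gmul x.2.2.1 y.2.2.2 - gmul x.2.2.2 y.2.2.1,
   gmul x.1 y.2.2.1 - gmul x.2.1 y.2.2.2 + gmul x.2.2.1 y.1 + gmul x.2.2.2 y.2.1,
   gmul x.1 y.2.2.2 + gmul x.2.1 y.2.2.1 - gmul x.2.2.1 y.2.1 + gmul x.2.2.2 y.1)

/-- Halving all the coordinates. -/
def half (x : HalfIcosian) : HalfIcosian :=
  ((x.1.1 / 2, x.1.2 / 2), (x.2.1.1 / 2, x.2.1.2 / 2), (x.2.2.1.1 / 2, x.2.2.1.2 / 2),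
    (x.2.2.2.1 / 2, x.2.2.2.2 / 2))

/-- The conjugate. -/
def conj (x : HalfIcosian) : HalfIcosian := (x.1, -x.2.1, -x.2.2.1, -x.2.2.2)

/-- The product, if it has integral doubled coordinates. -/
def mul (x y : HalfIcosian) : HalfIcosian := half (dmul x y)

/-- The product of `x` and `y` has integral doubled coordinates. -/
def Exact (x y : HalfIcosian) : Prop := mul x y + mul x y = dmul x y

instance (x y : HalfIcosian) : Decidable (Exact x y) := by unfold Exact; infer_instance

/-- All products of an element of `A` and an element of `B`. -/
def products (A B : List HalfIcosian) : List HalfIcosian :=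
  A.flatMap fun x => B.map fun y => mul x y

/-- The real number `a + b φ`. -/
noncomputable def goldenReal (x : GoldenInt) : ℝ := x.1 + x.2 * φ

/-- The quaternion with given doubled coordinates. -/
noncomputable def toQuaternion (x : HalfIcosian) : ℍ[ℝ] :=
  ⟨goldenReal x.1 / 2, goldenReal x.2.1 / 2, goldenReal x.2.2.1 / 2, goldenReal x.2.2.2 / 2⟩

theorem re_toQuaternion (x : HalfIcosian) : (toQuaternion x).re = goldenReal x.1 / 2 := rfl

theorem imI_toQuaternion (x : HalfIcosian) : (toQuaternion x).imI = goldenReal x.2.1 / 2 := rfl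

theorem imJ_toQuaternion (x : HalfIcosian) : (toQuaternion x).imJ = goldenReal x.2.2.1 / 2 := rfl

theorem imK_toQuaternion (x : HalfIcosian) : (toQuaternion x).imK = goldenReal x.2.2.2 / 2 := rfl

/-- Irrationality of φ. This is what later turns one real equation between traces into two integer
equations. -/
theorem goldenReal_injective : Function.Injective goldenReal := by
  rintro ⟨a, b⟩ ⟨c, d⟩ h
  simp only [goldenReal] at h
  have hbd : b = d := by
    by_contra hne
    have h0 : ((b : ℝ) - d) ≠ 0 := sub_ne_zero.mpr (by exact_mod_cast hne)
    refine Real.goldenRatio_irrational ⟨((c - a : ℤ) : ℚ) / ((b - d : ℤ) : ℚ), ?_⟩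
    push_cast
    rw [div_eq_iff h0]
    linarith
  subst hbd
  have : (a : ℝ) = c := by linarith
  simp [Int.cast_injective this]

theorem toQuaternion_injective : Function.Injective toQuaternion := by
  rintro ⟨a, b, c, d⟩ ⟨a', b', c', d'⟩ h
  have h1 := congrArg QuaternionAlgebra.re h
  have h2 := congrArg QuaternionAlgebra.imI h
  have h3 := congrArg QuaternionAlgebra.imJ h
  have h4 := congrArg QuaternionAlgebra.imK h
  simp only [toQuaternion] at h1 h2 h3 h4
  rw [goldenReal_injective (a₁ := a) (a₂ := a') (by linarith),
    goldenReal_injective (a₁ := b) (a₂ := b') (by linarith),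
    goldenReal_injective (a₁ := c) (a₂ := c') (by linarith),
    goldenReal_injective (a₁ := d) (a₂ := d') (by linarith)]

theorem goldenReal_gmul (x y : GoldenInt) :
    goldenReal (gmul x y) = goldenReal x * goldenReal y := by
  simp only [goldenReal, gmul]
  push_cast
  linear_combination (-(x.2 : ℝ) * y.2) * Real.goldenRatio_sq

theorem goldenReal_add (x y : GoldenInt) :
    goldenReal (x + y) = goldenReal x + goldenReal y := by
  simp only [goldenReal, Prod.fst_add, Prod.snd_add]; push_cast; ring

theorem goldenReal_sub (x y : GoldenInt) :
    goldenReal (x - y) = goldenReal x - goldenReal y := by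
  simp only [goldenReal, Prod.fst_sub, Prod.snd_sub]; push_cast; ring

theorem goldenReal_neg (x : GoldenInt) : goldenReal (-x) = -goldenReal x := by
  simp only [goldenReal, Prod.fst_neg, Prod.snd_neg]; push_cast; ring

theorem toQuaternion_mul {x y : HalfIcosian} (h : Exact x y) :
    toQuaternion (mul x y) = toQuaternion x * toQuaternion y := by
  have h1 := congrArg (fun z => goldenReal z.1) h
  have h2 := congrArg (fun z => goldenReal z.2.1) h
  have h3 := congrArg (fun z => goldenReal z.2.2.1) h
  have h4 := congrArg (fun z => goldenReal z.2.2.2) h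
  simp only [dmul, Prod.fst_add, Prod.snd_add, goldenReal_add, goldenReal_sub,
    goldenReal_gmul] at h1 h2 h3 h4
  ext <;> simp only [re_toQuaternion, imI_toQuaternion, imJ_toQuaternion, imK_toQuaternion,
    Quaternion.re_mul, Quaternion.imI_mul, Quaternion.imJ_mul, Quaternion.imK_mul] <;> linarith

theorem toQuaternion_conj (x : HalfIcosian) :
    toQuaternion (conj x) = star (toQuaternion x) := by
  ext <;> simp [re_toQuaternion, imI_toQuaternion, imJ_toQuaternion,
    imK_toQuaternion, conj, goldenReal_neg, neg_div]

/-- `(1 + i + j + k) / 2`. -/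
def genA : HalfIcosian := ((1, 0), (1, 0), (1, 0), (1, 0))

/-- `(φ + φ⁻¹ i + j) / 2`. -/
def genB : HalfIcosian := ((0, 1), (-1, 1), (1, 0), (0, 0))

/-- `1`. -/
def one : HalfIcosian := ((2, 0), (0, 0), (0, 0), (0, 0))

/-- `i`. -/
def unitI : HalfIcosian := ((0, 0), (2, 0), (0, 0), (0, 0))

/-- `j`. -/
def unitJ : HalfIcosian := ((0, 0), (0, 0), (2, 0), (0, 0))

/-- The list of all elements of the binary icosahedral group. -/
def elements : List HalfIcosian :=
  -- The normal form i^a j^b A^c B^d with a < 4, b < 2, c < 3, d < 5. These exponents suffice for A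
  -- and B because A³ = B⁵ = -1 = i².
  products
    (products
      (products [one, unitI, mul unitI unitI, mul (mul unitI unitI) unitI] [one, unitJ])
      [one, genA, mul genA genA])
    [one, genB, mul genB genB, mul (mul genB genB) genB, mul (mul genB genB) (mul genB genB)]

theorem length_elements : elements.length = 120 := by decide +kernel

theorem nodup_elements : elements.Nodup := by decide +kernel

/-- Closure under left multiplication by the generators and their inverses suffices: together with 1
it places the whole generated group in the list. -/
theorem closed_elements : ∀ g ∈ [genA, conj genA, genB, conj genB], ∀ x ∈ elements,
    Exact g x ∧ mul g x ∈ elements := by decide +kernel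

theorem norm_elements : ∀ x ∈ elements, Exact (conj x) x ∧ mul (conj x) x = one := by
  decide +kernel

theorem trace_elements : ∀ x ∈ elements, x.1 ∈ ([(2, 0), (-2, 0), (0, 1), (0, -1), (1, 0),
    (-1, 0), (-1, 1), (1, -1), (0, 0)] : List GoldenInt) := by decide +kernel

theorem toQuaternion_one : toQuaternion one = 1 := by
  ext <;> simp [toQuaternion, goldenReal, one]

/-! ### The list is exactly the generated group -/

/-- The quaternion with the given doubled coordinates is in the binary icosahedral group. -/
def Represents (x : HalfIcosian) : Prop :=
  ∃ u ∈ binaryIcosahedral, (u : ℍ[ℝ]) = toQuaternion x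

theorem Represents.mul {x y : HalfIcosian} (hx : Represents x) (hy : Represents y)
    (h : Exact x y) : Represents (mul x y) := by
  obtain ⟨u, hu, hux⟩ := hx
  obtain ⟨v, hv, hvy⟩ := hy
  exact ⟨u * v, mul_mem hu hv, by rw [Units.val_mul, hux, hvy, toQuaternion_mul h]⟩

theorem represents_one : Represents one := ⟨1, one_mem _, by rw [toQuaternion_one]; rfl⟩

theorem Represents.products {A B : List HalfIcosian} (hA : ∀ x ∈ A, Represents x)
    (hB : ∀ x ∈ B, Represents x) (h : ∀ x ∈ A, ∀ y ∈ B, Exact x y) :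
    ∀ x ∈ products A B, Represents x := by
  intro z hz
  simp only [HalfIcosian.products, List.mem_flatMap, List.mem_map] at hz
  obtain ⟨x, hx, y, hy, rfl⟩ := hz
  exact (hA x hx).mul (hB y hy) (h x hx y hy)

theorem conj_mul_self_toQuaternion {x : HalfIcosian} (h : Exact (conj x) x)
    (h1 : HalfIcosian.mul (conj x) x = one) : toQuaternion (conj x) * toQuaternion x = 1 := by
  rw [← toQuaternion_mul h, h1, toQuaternion_one]

theorem Represents.conj {x : HalfIcosian} (hx : Represents x) (h : Exact (conj x) x)
    (h1 : HalfIcosian.mul (conj x) x = one) : Represents (conj x) := by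
  obtain ⟨u, hu, hux⟩ := hx
  refine ⟨u⁻¹, inv_mem hu, ?_⟩
  have := conj_mul_self_toQuaternion h h1
  rw [← hux] at this
  exact (Units.inv_eq_of_mul_eq_one_left this).symm ▸ rfl

theorem toQuaternion_genA : toQuaternion genA = ⟨1 / 2, 1 / 2, 1 / 2, 1 / 2⟩ := by
  ext <;> simp [toQuaternion, goldenReal, genA]

theorem goldenRatio_inv : φ⁻¹ = φ - 1 := by
  refine inv_eq_of_mul_eq_one_left ?_
  linear_combination Real.goldenRatio_sq

theorem toQuaternion_genB : toQuaternion genB = ⟨φ / 2, φ⁻¹ / 2, 1 / 2, 0⟩ := by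
  rw [goldenRatio_inv]
  ext <;> simp [toQuaternion, goldenReal, genB]
  ring

theorem exists_unit {x : HalfIcosian} (h : Exact (conj x) x)
    (h1 : HalfIcosian.mul (conj x) x = one) : ∃ u : ℍ[ℝ]ˣ, (u : ℍ[ℝ]) = toQuaternion x := by
  have h2 := conj_mul_self_toQuaternion h h1
  exact ⟨⟨toQuaternion x, toQuaternion (conj x), mul_eq_one_comm.mp h2, h2⟩, rfl⟩

theorem represents_genA : Represents genA := by
  obtain ⟨u, hu⟩ := exists_unit (x := genA) (by decide) (by decide)
  exact ⟨u, Subgroup.subset_closure (Or.inl (hu.trans toQuaternion_genA)), hu⟩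

theorem represents_genB : Represents genB := by
  obtain ⟨u, hu⟩ := exists_unit (x := genB) (by decide) (by decide)
  exact ⟨u, Subgroup.subset_closure (Or.inr (hu.trans toQuaternion_genB)), hu⟩

theorem represents_unitI : Represents unitI := by
  have hA := represents_genA
  have hB := represents_genB
  have hB' : Represents (HalfIcosian.conj genB) := hB.conj (by decide) (by decide)
  -- The word i = B A B⁻¹ A B⁻¹, confirmed by evaluating coordinates.
  exact (((hB.mul hA (by decide)).mul hB' (by decide)).mul hA (by decide)).mul hB' (by decide)

theorem represents_unitJ : Represents unitJ := by
  have hA := represents_genA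
  have hB := represents_genB
  have hB' : Represents (HalfIcosian.conj genB) := hB.conj (by decide) (by decide)
  -- The word j = B⁻¹ A B².
  exact ((hB'.mul hA (by decide)).mul hB (by decide)).mul hB (by decide)

theorem represents_of_mem_elements : ∀ x ∈ elements, Represents x := by
  have hA := represents_genA
  have hB := represents_genB
  have hI := represents_unitI
  have hJ := represents_unitJ
  have h1 := represents_one
  have hI2 := hI.mul hI (by decide)
  have hI3 := hI2.mul hI (by decide)
  have hA2 := hA.mul hA (by decide)
  have hB2 := hB.mul hB (by decide)
  have hB3 := hB2.mul hB (by decide)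
  have hB4 := hB2.mul hB2 (by decide)
  refine Represents.products (Represents.products (Represents.products ?_ ?_ ?_) ?_ ?_) ?_ ?_
  · simp [h1, hI, hI2, hI3]
  · simp [h1, hJ]
  · decide +kernel
  · simp [h1, hA, hA2]
  · decide +kernel
  · simp [h1, hB, hB2, hB3, hB4]
  · decide +kernel

theorem exists_mem_elements {u : ℍ[ℝ]ˣ} (hu : u ∈ binaryIcosahedral) :
    ∃ x ∈ elements, (u : ℍ[ℝ]) = toQuaternion x := by
  refine Subgroup.closure_induction_left
    (p := fun (u : ℍ[ℝ]ˣ) _ => ∃ x ∈ elements, (u : ℍ[ℝ]) = toQuaternion x) ?_ ?_ ?_ hu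
  · exact ⟨one, by decide +kernel, by rw [toQuaternion_one]; rfl⟩
  · rintro g hg y - ⟨x, hx, hyx⟩
    obtain ⟨g', hg', hgg⟩ : ∃ g' ∈ [genA, conj genA, genB, conj genB],
        (g : ℍ[ℝ]) = toQuaternion g' := by
      rcases hg with hg | hg
      · exact ⟨genA, by simp, hg.trans toQuaternion_genA.symm⟩
      · exact ⟨genB, by simp, hg.trans toQuaternion_genB.symm⟩
    obtain ⟨h1, h2⟩ := closed_elements g' hg' x hx
    exact ⟨_, h2, by rw [toQuaternion_mul h1, Units.val_mul, hgg, hyx]⟩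
  · rintro g hg y - ⟨x, hx, hyx⟩
    obtain ⟨g', hg', hgg⟩ : ∃ g' ∈ [genA, conj genA, genB, conj genB],
        ((g⁻¹ : ℍ[ℝ]ˣ) : ℍ[ℝ]) = toQuaternion g' := by
      rcases hg with hg | hg
      · refine ⟨conj genA, by simp, Units.inv_eq_of_mul_eq_one_left ?_⟩
        rw [hg, ← toQuaternion_genA]
        exact conj_mul_self_toQuaternion (by decide) (by decide)
      · refine ⟨conj genB, by simp, Units.inv_eq_of_mul_eq_one_left ?_⟩
        rw [hg, ← toQuaternion_genB]
        exact conj_mul_self_toQuaternion (by decide) (by decide)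
    obtain ⟨h1, h2⟩ := closed_elements g' hg' x hx
    exact ⟨_, h2, by rw [toQuaternion_mul h1, Units.val_mul, hgg, hyx]⟩

end HalfIcosian

open HalfIcosian in
theorem coe_image_binaryIcosahedral :
    (fun u : ℍ[ℝ]ˣ => (u : ℍ[ℝ])) '' binaryIcosahedral = toQuaternion '' {x | x ∈ elements} := by
  ext q
  constructor
  · rintro ⟨u, hu, rfl⟩
    obtain ⟨x, hx, h⟩ := exists_mem_elements hu
    exact ⟨x, hx, h.symm⟩
  · rintro ⟨x, hx, rfl⟩
    obtain ⟨u, hu, h⟩ := represents_of_mem_elements x hx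
    exact ⟨u, hu, h⟩

open HalfIcosian in
theorem ncard_coe_image_binaryIcosahedral :
    ((fun u : ℍ[ℝ]ˣ => (u : ℍ[ℝ])) '' binaryIcosahedral).ncard = 120 := by
  rw [coe_image_binaryIcosahedral, Set.ncard_image_of_injective _ toQuaternion_injective,
    ← List.coe_toFinset, Set.ncard_coe_finset, List.toFinset_card_of_nodup nodup_elements,
    length_elements]

theorem card_binaryIcosahedral : Nat.card binaryIcosahedral = 120 := by
  rw [← ncard_coe_image_binaryIcosahedral, Set.ncard_image_of_injective _ Units.val_injective]
  rfl

instance finite_binaryIcosahedral : Finite binaryIcosahedral :=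
  Nat.finite_of_card_ne_zero (by rw [card_binaryIcosahedral]; norm_num)

open HalfIcosian in
theorem star_mul_self_of_mem {u : ℍ[ℝ]ˣ} (hu : u ∈ binaryIcosahedral) :
    star (u : ℍ[ℝ]) * u = 1 := by
  obtain ⟨x, hx, h⟩ := exists_mem_elements hu
  obtain ⟨h1, h2⟩ := norm_elements x hx
  rw [h, ← toQuaternion_conj, conj_mul_self_toQuaternion h1 h2]

open HalfIcosian in
theorem trace_of_mem {u : ℍ[ℝ]ˣ} (hu : u ∈ binaryIcosahedral) :
    ∃ t ∈ ([(2, 0), (-2, 0), (0, 1), (0, -1), (1, 0), (-1, 0), (-1, 1), (1, -1), (0, 0)] :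
      List GoldenInt), 2 * (u : ℍ[ℝ]).re = goldenReal t := by
  obtain ⟨x, hx, h⟩ := exists_mem_elements hu
  refine ⟨x.1, trace_elements x hx, ?_⟩
  rw [h]
  simp only [toQuaternion]
  ring

theorem neg_one_mem_binaryIcosahedral : (-1 : ℍ[ℝ]ˣ) ∈ binaryIcosahedral := by
  obtain ⟨u, hu, h⟩ := HalfIcosian.represents_unitI
  convert mul_mem hu hu using 1
  ext <;> simp [h, HalfIcosian.re_toQuaternion, HalfIcosian.imI_toQuaternion,
    HalfIcosian.imJ_toQuaternion, HalfIcosian.imK_toQuaternion, HalfIcosian.unitI,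
    HalfIcosian.goldenReal]

/-! ### Traces and orders of subgroups of the binary icosahedral group -/

namespace BinaryIcosahedral

open HalfIcosian

noncomputable instance : Fintype binaryIcosahedral := Fintype.ofFinite _

noncomputable instance : DecidableEq binaryIcosahedral := Classical.decEq _

/-- The inclusion of the binary icosahedral group into the quaternions. -/
noncomputable def toQuat : binaryIcosahedral →* ℍ[ℝ] :=
  (Units.coeHom ℍ[ℝ]).comp binaryIcosahedral.subtype

theorem toQuat_injective : Function.Injective toQuat :=
  Units.val_injective.comp Subtype.val_injective

theorem star_mul_toQuat (x : binaryIcosahedral) : star (toQuat x) * toQuat x = 1 :=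
  star_mul_self_of_mem x.2

theorem toQuat_inv (x : binaryIcosahedral) : toQuat x⁻¹ = star (toQuat x) := by
  rw [← mul_one (star _), ← map_one toQuat, ← mul_inv_cancel x, map_mul, ← mul_assoc,
    star_mul_toQuat, one_mul]

/-- The element `-1`. -/
noncomputable def negOne : binaryIcosahedral := ⟨-1, neg_one_mem_binaryIcosahedral⟩

theorem toQuat_negOne : toQuat negOne = -1 := rfl

theorem negOne_mul_self : negOne * negOne = 1 :=
  toQuat_injective (by rw [map_mul, toQuat_negOne, map_one]; norm_num)

theorem negOne_ne_one : negOne ≠ 1 := by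
  intro h
  have h1 := congrArg (fun x => (toQuat x).re) h
  simp only [toQuat_negOne, map_one, Quaternion.re_neg, Quaternion.re_one] at h1
  norm_num at h1

theorem negOne_comm (x : binaryIcosahedral) : negOne * x = x * negOne :=
  toQuat_injective (by simp [toQuat_negOne])

/-- The trace `2 Re x` of an element of the binary icosahedral group, as an element of `ℤ[φ]`. -/
noncomputable def trace (x : binaryIcosahedral) : GoldenInt := (trace_of_mem x.2).choose

theorem trace_mem (x : binaryIcosahedral) : trace x ∈ ([(2, 0), (-2, 0), (0, 1), (0, -1), (1, 0),
    (-1, 0), (-1, 1), (1, -1), (0, 0)] : List GoldenInt) :=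
  (trace_of_mem x.2).choose_spec.1

theorem goldenReal_trace (x : binaryIcosahedral) :
    goldenReal (trace x) = 2 * (toQuat x).re :=
  (trace_of_mem x.2).choose_spec.2.symm

theorem re_mul_comm (a b : ℍ[ℝ]) : (a * b).re = (b * a).re := by
  simp only [Quaternion.re_mul]; ring

theorem trace_conj (p x : binaryIcosahedral) : trace (p * x * p⁻¹) = trace x := by
  apply goldenReal_injective
  rw [goldenReal_trace, goldenReal_trace, map_mul, re_mul_comm, ← map_mul, ← mul_assoc,
    inv_mul_cancel, one_mul]

/-- Cayley–Hamilton for a quaternion of norm 1. The trace thus determines the order of an element.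
-/
theorem toQuat_mul_self (x : binaryIcosahedral) :
    toQuat x * toQuat x = goldenReal (trace x) • toQuat x - 1 := by
  have h := star_mul_toQuat x
  rw [goldenReal_trace]
  have h2 : toQuat x = ((2 * (toQuat x).re : ℝ) : ℍ[ℝ]) - star (toQuat x) := by
    ext <;> simp; ring
  nth_rewrite 1 [h2]
  rw [sub_mul, h, Quaternion.coe_mul_eq_smul]

theorem pow_three_eq_neg_one {R : Type*} [Ring R] [Algebra ℝ R] {q : R}
    (h : q * q = (1 : ℝ) • q - 1) : q ^ 3 = -1 := by
  have : q ^ 3 = q * (q * q) := by noncomm_ring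
  rw [this, h, mul_sub, mul_smul_comm, h]
  simp

/-- X⁵ + 1 = (X + 1)(X² - φX + 1)(X² - (1 - φ)X + 1), and φ, 1 - φ are the two roots of t² = t + 1.
-/
theorem pow_five_eq_neg_one {R : Type*} [Ring R] [Algebra ℝ R] {q : R} {t : ℝ}
    (ht : t ^ 2 = t + 1) (h : q * q = t • q - 1) : q ^ 5 = -1 := by
  have h3 : q * (q * q) = t • q - t • 1 := by
    rw [h, mul_sub, mul_smul_comm, h, mul_one]
    match_scalars
    · linear_combination ht
    · ring
  have h5 : q ^ 5 = (q * (q * q)) * (q * q) := by noncomm_ring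
  rw [h5, h3, h, sub_mul, mul_sub, smul_mul_smul_comm, h]
  simp only [smul_mul_assoc, one_mul, mul_one]
  match_scalars
  · linear_combination t * ht
  · linear_combination -ht

theorem eq_one_of_trace {x : binaryIcosahedral} (h : trace x = (2, 0)) : x = 1 := by
  have h1 := toQuat_mul_self x
  rw [h] at h1
  have h2 : (toQuat x - 1) * (toQuat x - 1) = 0 := by
    rw [sub_mul, mul_sub, h1, one_mul, mul_one]
    simp only [goldenReal]
    module
  exact toQuat_injective (by rw [map_one, sub_eq_zero.mp (mul_self_eq_zero.mp h2)])

theorem eq_negOne_of_trace {x : binaryIcosahedral} (h : trace x = (-2, 0)) : x = negOne := by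
  have h1 := toQuat_mul_self x
  rw [h] at h1
  have h2 : (toQuat x + 1) * (toQuat x + 1) = 0 := by
    rw [add_mul, mul_add, h1, one_mul, mul_one]
    simp only [goldenReal]
    push_cast
    module
  exact toQuat_injective (by rw [toQuat_negOne, eq_neg_of_add_eq_zero_left
    (mul_self_eq_zero.mp h2)])

theorem eq_one_or_eq_negOne {x : binaryIcosahedral} (h : x * x = 1) : x = 1 ∨ x = negOne := by
  have h1 : toQuat x * toQuat x = 1 := by rw [← map_mul, h, map_one]
  rcases mul_self_eq_one_iff.mp h1 with h2 | h2
  · exact Or.inl (toQuat_injective (by rw [h2, map_one]))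
  · exact Or.inr (toQuat_injective (by rw [h2, toQuat_negOne]))

theorem goldenConj_sq' : (1 - φ) ^ 2 = (1 - φ) + 1 := by
  linear_combination Real.goldenRatio_sq

/-- Elements of trace φ, 1, 1 - φ and 0 have -1 as their 5th, 3rd, 5th and 2nd power. What remains
is the identity and the traces belonging to orders 3 and 5. -/
theorem trace_of_negOne_notMem {S : Subgroup binaryIcosahedral} (hS : negOne ∉ S)
    {x : binaryIcosahedral} (hx : x ∈ S) :
    trace x = (2, 0) ∨ trace x = (-1, 1) ∨ trace x = (-1, 0) ∨ trace x = (0, -1) := by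
  have key : ∀ n : ℕ, toQuat x ^ n = -1 → False := fun n hn => hS (by
    have : x ^ n = negOne := toQuat_injective (by rw [map_pow, hn, toQuat_negOne])
    exact this ▸ pow_mem hx n)
  have h1 := toQuat_mul_self x
  have h := trace_mem x
  simp only [List.mem_cons, List.not_mem_nil, or_false] at h
  rcases h with h | h | h | h | h | h | h | h | h
  · exact Or.inl h
  · exact absurd (eq_negOne_of_trace h ▸ hx) hS
  · refine (key 5 (pow_five_eq_neg_one (t := φ) Real.goldenRatio_sq ?_)).elim
    rw [h1, h]; simp [goldenReal]
  · simp [h]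
  · refine (key 3 (pow_three_eq_neg_one ?_)).elim
    rw [h1, h]; simp [goldenReal]
  · simp [h]
  · simp [h]
  · refine (key 5 (pow_five_eq_neg_one (t := 1 - φ) goldenConj_sq' ?_)).elim
    rw [h1, h]; simp [goldenReal, sub_eq_add_neg]
  · refine (key 2 ?_).elim
    rw [pow_two, h1, h]; simp [goldenReal]

/-! ### Vanishing sums and the bounds they give -/

/-- The elements of a subgroup. -/
noncomputable def members (S : Subgroup binaryIcosahedral) : Finset binaryIcosahedral :=
  open Classical in Finset.univ.filter (· ∈ S)

theorem mem_members {S : Subgroup binaryIcosahedral} {x : binaryIcosahedral} :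
    x ∈ members S ↔ x ∈ S := by simp [members]

theorem card_members (S : Subgroup binaryIcosahedral) : (members S).card = Nat.card S := by
  classical
  rw [Nat.card_eq_fintype_card, Fintype.card_subtype]
  rfl

/-- The sum is fixed by left multiplication by some h ≠ 1 in S, and h - 1 is invertible in the
quaternions. -/
theorem sum_toQuat_eq_zero {S : Subgroup binaryIcosahedral} (hS : S ≠ ⊥) :
    ∑ x ∈ members S, toQuat x = 0 := by
  obtain ⟨h, hh, h1⟩ := S.bot_or_exists_ne_one.resolve_left hS
  have h2 : ∑ x ∈ members S, toQuat x = toQuat h * ∑ x ∈ members S, toQuat x := by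
    rw [Finset.mul_sum]
    refine Finset.sum_bij' (fun x _ => h⁻¹ * x) (fun x _ => h * x) ?_ ?_ ?_ ?_ ?_
    · intro x hx
      exact mem_members.mpr (mul_mem (inv_mem hh) (mem_members.mp hx))
    · intro x hx
      exact mem_members.mpr (mul_mem hh (mem_members.mp hx))
    · simp
    · simp
    · intro x _
      rw [← map_mul, mul_inv_cancel_left]
  have h3 : (toQuat h - 1) * ∑ x ∈ members S, toQuat x = 0 := by
    rw [sub_mul, one_mul, ← h2, sub_self]
  refine (mul_eq_zero.mp h3).resolve_left fun h4 => h1 (toQuat_injective ?_)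
  rw [map_one, sub_eq_zero.mp h4]

theorem goldenReal_sum {ι : Type*} (s : Finset ι) (f : ι → GoldenInt) :
    goldenReal (∑ i ∈ s, f i) = ∑ i ∈ s, goldenReal (f i) := by
  simp only [goldenReal, Prod.fst_sum, Prod.snd_sum, Int.cast_sum, Finset.sum_add_distrib,
    Finset.sum_mul]

theorem re_sum {ι : Type*} (s : Finset ι) (f : ι → ℍ[ℝ]) :
    (∑ i ∈ s, f i).re = ∑ i ∈ s, (f i).re := by
  classical
  induction s using Finset.induction_on with
  | empty => simp
  | insert a s ha ih => rw [Finset.sum_insert ha, Finset.sum_insert ha, Quaternion.re_add, ih]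

theorem sum_trace_eq_zero {S : Subgroup binaryIcosahedral} (hS : S ≠ ⊥) :
    ∑ x ∈ members S, trace x = 0 := by
  apply goldenReal_injective
  rw [goldenReal_sum]
  simp only [goldenReal_trace]
  rw [← Finset.mul_sum, ← re_sum, sum_toQuat_eq_zero hS]
  simp [goldenReal]

/-- The number of elements of given trace in a finite set. -/
noncomputable def traceCount (s : Finset binaryIcosahedral) (t : GoldenInt) : ℕ :=
  (s.filter fun x => trace x = t).card

theorem traceCount_cast (s : Finset binaryIcosahedral) (t : GoldenInt) :
    (traceCount s t : ℤ) = ∑ x ∈ s, if trace x = t then 1 else 0 := by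
  rw [traceCount, Finset.sum_boole]

/-- Let a, b, c count the traces φ - 1, -1, -φ. The vanishing trace sum gives a + b = 2 (coefficient
of 1) and a = c (coefficient of φ), so |S| = 1 + a + b + c = 3 + a ≤ 5. -/
theorem card_le_five_and_traceCount_le_two {S : Subgroup binaryIcosahedral} (hS : negOne ∉ S)
    (hS' : S ≠ ⊥) : Nat.card S ≤ 5 ∧ ∀ t ≠ (2, 0), traceCount (members S) t ≤ 2 := by
  have htr : ∀ x ∈ members S, _ := fun x hx => trace_of_negOne_notMem hS (mem_members.mp hx)
  have h0 := sum_trace_eq_zero hS'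
  have h1 := congrArg Prod.fst h0
  have h2 := congrArg Prod.snd h0
  rw [Prod.fst_sum] at h1
  rw [Prod.snd_sum] at h2
  have e1 : ∑ x ∈ members S, (trace x).1 = 2 * (traceCount (members S) (2, 0) : ℤ)
      - traceCount (members S) (-1, 1) - traceCount (members S) (-1, 0) := by
    simp only [traceCount_cast, Finset.mul_sum, ← Finset.sum_sub_distrib]
    refine Finset.sum_congr rfl fun x hx => ?_
    rcases htr x hx with h | h | h | h <;> simp [h]
  have e2 : ∑ x ∈ members S, (trace x).2 = (traceCount (members S) (-1, 1) : ℤ)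
      - traceCount (members S) (0, -1) := by
    simp only [traceCount_cast, ← Finset.sum_sub_distrib]
    refine Finset.sum_congr rfl fun x hx => ?_
    rcases htr x hx with h | h | h | h <;> simp [h]
  have e3 : ((members S).card : ℤ) = (traceCount (members S) (2, 0) : ℤ)
      + traceCount (members S) (-1, 1) + traceCount (members S) (-1, 0)
      + traceCount (members S) (0, -1) := by
    simp only [traceCount_cast, ← Finset.sum_add_distrib]
    rw [Finset.card_eq_sum_ones, Nat.cast_sum]
    refine Finset.sum_congr rfl fun x hx => ?_
    rcases htr x hx with h | h | h | h <;> simp [h]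
  have e4 : traceCount (members S) (2, 0) ≤ 1 := by
    refine (Finset.card_le_card (t := {1}) fun x hx => ?_).trans (by simp)
    exact Finset.mem_singleton.mpr (eq_one_of_trace (Finset.mem_filter.mp hx).2)
  rw [e1] at h1
  rw [e2] at h2
  simp only [Prod.fst_zero, Prod.snd_zero] at h1 h2
  rw [← card_members]
  refine ⟨by omega, fun t ht => ?_⟩
  rcases Nat.eq_zero_or_pos (traceCount (members S) t) with h | h
  · omega
  · obtain ⟨x, hx⟩ := Finset.card_pos.mp h
    obtain ⟨hx', rfl⟩ := Finset.mem_filter.mp hx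
    rcases htr x hx' with h | h | h | h
    · exact absurd h ht
    all_goals rw [h]; omega

/-- Sum the squares over the centralizer: replacing x by g x multiplies the sum by g² ≠ 1, so it
vanishes. The trace of x² is t² - 2. If n, a, b, c, d count t = ±2, ±φ, ±1, 0, ±(φ - 1), then 2n = a
+ b + 2c and a = d, so the order n + 2a + b + c is at most 5n ≤ 10. -/
theorem card_commuting_le_ten {g : binaryIcosahedral} (hg : g ≠ 1) (hg' : g ≠ negOne) :
    (Finset.univ.filter fun x => x * g = g * x).card ≤ 10 := by
  set s := Finset.univ.filter fun x : binaryIcosahedral => x * g = g * x with hs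
  have hmem : ∀ x, x ∈ s ↔ x * g = g * x := by simp [hs]
  have h0 : ∑ x ∈ s, toQuat (x * x) = toQuat (g * g) * ∑ x ∈ s, toQuat (x * x) := by
    rw [Finset.mul_sum]
    refine Finset.sum_bij' (fun x _ => g⁻¹ * x) (fun x _ => g * x) ?_ ?_ ?_ ?_ ?_
    · intro x hx
      rw [hmem] at hx ⊢
      rw [mul_assoc, hx]; group
    · intro x hx
      rw [hmem] at hx ⊢
      rw [mul_assoc, hx]
    · simp
    · simp
    · intro x hx
      rw [hmem] at hx
      rw [← map_mul]
      congr 1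
      have : x * g⁻¹ = g⁻¹ * x := by
        rw [mul_inv_eq_iff_eq_mul, mul_assoc, hx, inv_mul_cancel_left]
      calc x * x = g * g * (g⁻¹ * (g⁻¹ * x) * x) := by group
        _ = g * g * (g⁻¹ * (x * g⁻¹) * x) := by rw [this]
        _ = g * g * (g⁻¹ * x * (g⁻¹ * x)) := by group
  have h1 : ∑ x ∈ s, toQuat (x * x) = 0 := by
    have h3 : (toQuat (g * g) - 1) * ∑ x ∈ s, toQuat (x * x) = 0 := by
      rw [sub_mul, one_mul, ← h0, sub_self]
    refine (mul_eq_zero.mp h3).resolve_left fun h4 => ?_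
    have : g * g = 1 := toQuat_injective (by rw [map_one, sub_eq_zero.mp h4])
    exact (eq_one_or_eq_negOne this).elim hg hg'
  have h2 : ∑ x ∈ s, (gmul (trace x) (trace x) - (2, 0)) = 0 := by
    apply goldenReal_injective
    rw [goldenReal_sum]
    have : ∀ x ∈ s, goldenReal (gmul (trace x) (trace x) - (2, 0)) =
        2 * (toQuat (x * x)).re := by
      intro x _
      rw [map_mul, toQuat_mul_self, goldenReal_sub, goldenReal_gmul, Quaternion.re_sub,
        Quaternion.re_smul, goldenReal_trace]
      simp [goldenReal]
      ring
    rw [Finset.sum_congr rfl this, ← Finset.mul_sum, ← re_sum, h1]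
    simp [goldenReal]
  have f1 := congrArg Prod.fst h2
  have f2 := congrArg Prod.snd h2
  rw [Prod.fst_sum] at f1
  rw [Prod.snd_sum] at f2
  have htr : ∀ x, _ := fun x => trace_mem x
  simp only [List.mem_cons, List.not_mem_nil, or_false] at htr
  have e1 : ∑ x ∈ s, (gmul (trace x) (trace x) - (2, 0)).1 =
      2 * (traceCount s (2, 0) : ℤ) + 2 * (traceCount s (-2, 0) : ℤ) - traceCount s (0, 1)
      - traceCount s (0, -1) - traceCount s (1, 0) - traceCount s (-1, 0)
      - 2 * (traceCount s (0, 0) : ℤ) := by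
    simp only [traceCount_cast, Finset.mul_sum, ← Finset.sum_sub_distrib, ← Finset.sum_add_distrib]
    refine Finset.sum_congr rfl fun x hx => ?_
    rcases htr x with h | h | h | h | h | h | h | h | h <;> simp [h, gmul]
  have e2 : ∑ x ∈ s, (gmul (trace x) (trace x) - (2, 0)).2 =
      (traceCount s (0, 1) : ℤ) + traceCount s (0, -1) - traceCount s (-1, 1)
      - traceCount s (1, -1) := by
    simp only [traceCount_cast, ← Finset.sum_sub_distrib, ← Finset.sum_add_distrib]
    refine Finset.sum_congr rfl fun x hx => ?_
    rcases htr x with h | h | h | h | h | h | h | h | h <;> simp [h, gmul]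
  have e3 : (s.card : ℤ) =
      (traceCount s (2, 0) : ℤ) + traceCount s (-2, 0) + traceCount s (0, 1)
      + traceCount s (0, -1) + traceCount s (1, 0) + traceCount s (-1, 0)
      + traceCount s (-1, 1) + traceCount s (1, -1) + traceCount s (0, 0) := by
    simp only [traceCount_cast, ← Finset.sum_add_distrib]
    rw [Finset.card_eq_sum_ones, Nat.cast_sum]
    refine Finset.sum_congr rfl fun x hx => ?_
    rcases htr x with h | h | h | h | h | h | h | h | h <;> simp [h]
  have e4 : traceCount s (2, 0) ≤ 1 := by
    refine (Finset.card_le_card (t := {1}) fun x hx => ?_).trans (by simp)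
    exact Finset.mem_singleton.mpr (eq_one_of_trace (Finset.mem_filter.mp hx).2)
  have e5 : traceCount s (-2, 0) ≤ 1 := by
    refine (Finset.card_le_card (t := {negOne}) fun x hx => ?_).trans (by simp)
    exact Finset.mem_singleton.mpr (eq_negOne_of_trace (Finset.mem_filter.mp hx).2)
  rw [e1] at f1
  rw [e2] at f2
  simp only [Prod.fst_zero, Prod.snd_zero] at f1 f2
  omega

/-- Let P conjugate a nontrivial g in S. The conjugates lie in S and share the trace of g, so there
are at most 2; each fibre lies in a coset of the centralizer of g, so has at most 10 elements. -/
theorem card_le_twenty_of_normalizes {S P : Subgroup binaryIcosahedral} (hS : negOne ∉ S)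
    (hS' : S ≠ ⊥) (hP : ∀ p ∈ P, ∀ x ∈ S, p * x * p⁻¹ ∈ S) : Nat.card P ≤ 20 := by
  obtain ⟨g, hg, hg1⟩ := S.bot_or_exists_ne_one.resolve_left hS'
  have hg2 : g ≠ negOne := fun h => hS (h ▸ hg)
  rw [← card_members]
  refine (Finset.card_le_mul_card_image (f := fun p => p * g * p⁻¹) _ 10 ?_).trans
    (Nat.mul_le_mul_left 10 (m := 2) ?_)
  · intro b hb
    obtain ⟨p₀, -, rfl⟩ := Finset.mem_image.mp hb
    refine (Finset.card_le_card_of_injOn (fun p => p₀⁻¹ * p) (fun p hp => ?_)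
      (mul_right_injective p₀⁻¹).injOn).trans (card_commuting_le_ten hg1 hg2)
    have hp' := (Finset.mem_filter.mp hp).2
    simp only [Finset.coe_filter, Finset.mem_univ, true_and, Set.mem_ofPred_eq]
    have h1 : p * g = p₀ * g * p₀⁻¹ * p := by rw [← hp']; group
    rw [mul_assoc, h1]; group
  · refine (Finset.card_le_card fun x hx => ?_).trans
      ((card_le_five_and_traceCount_le_two hS hS').2 (trace g) fun h => hg1 (eq_one_of_trace h))
    obtain ⟨p, hp, rfl⟩ := Finset.mem_image.mp hx
    exact Finset.mem_filter.mpr ⟨mem_members.mpr (hP p (mem_members.mp hp) g hg), trace_conj p g⟩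

/-- Otherwise the whole group, of order 120, would normalize N, against the bound 20. -/
theorem negOne_mem_of_normal {N : Subgroup binaryIcosahedral} (hN : N.Normal) (hN' : N ≠ ⊥) :
    negOne ∈ N := by
  by_contra h
  have h1 := card_le_twenty_of_normalizes (P := ⊤) h hN' fun p _ x hx => hN.conj_mem x hx p
  rw [Subgroup.card_top, card_binaryIcosahedral] at h1
  omega

theorem mem_center_iff {x : binaryIcosahedral} :
    x ∈ Subgroup.center binaryIcosahedral ↔ x = 1 ∨ x = negOne := by
  constructor
  · intro hx
    by_contra! h
    have h1 := card_commuting_le_ten h.1 h.2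
    rw [Finset.filter_true_of_mem fun y _ => Subgroup.mem_center_iff.mp hx y, Finset.card_univ,
      ← Nat.card_eq_fintype_card, card_binaryIcosahedral] at h1
    omega
  · rintro (rfl | rfl)
    · exact one_mem _
    · exact Subgroup.mem_center_iff.mpr fun y => (negOne_comm y).symm

end BinaryIcosahedral

/-! ### Minimal degrees -/

theorem minimalDegree_le_card {G X : Type*} [Group G] [Finite X] (f : G →* Equiv.Perm X)
    (hf : Function.Injective f) : minimalDegree G ≤ Nat.card X := by
  refine Nat.sInf_le ⟨((Finite.equivFin X).permCongrHom : _ →* _).comp f, ?_⟩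
  exact ((Finite.equivFin X).permCongrHom.injective).comp hf

/-- Cayley's theorem makes the set of degrees nonempty, so the infimum is attained and is not the
default value 0. -/
theorem exists_injective_minimalDegree (G : Type*) [Group G] [Finite G] :
    ∃ f : G →* Equiv.Perm (Fin (minimalDegree G)), Function.Injective f := by
  refine Nat.sInf_mem (s := {n : ℕ | ∃ f : G →* Equiv.Perm (Fin n), Function.Injective f})
    ⟨Nat.card G, ((Finite.equivFin G).permCongrHom : _ →* _).comp (MulAction.toPermHom G G), ?_⟩
  exact ((Finite.equivFin G).permCongrHom.injective).comp MulAction.toPerm_injective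

theorem minimalDegree_le_of_injective {G H : Type*} [Group G] [Group H] [Finite H] (f : G →* H)
    (hf : Function.Injective f) : minimalDegree G ≤ minimalDegree H := by
  obtain ⟨g, hg⟩ := exists_injective_minimalDegree H
  simpa using minimalDegree_le_card (g.comp f) (hg.comp hf)

/-! ### The action of the central square by left and right multiplication -/

namespace CentralSquare

variable {G : Type*} [Group G]

/-- The pair `(p, q)` acts on `G` by `u ↦ p u q⁻¹`. -/
def leftRight (G : Type*) [Group G] : G × G →* Equiv.Perm G where
  toFun p := (Equiv.mulLeft p.1).trans (Equiv.mulRight p.2⁻¹)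
  map_one' := by ext; simp
  map_mul' p q := by ext; simp [mul_assoc]

@[simp]
theorem leftRight_apply (p : G × G) (u : G) : leftRight G p u = p.1 * u * p.2⁻¹ := rfl

/-- Evaluation at 1 forces p = q, and then p u p⁻¹ = u for all u says that p is central. -/
theorem ker_leftRight : (leftRight G).ker = diagonalCenter G := by
  ext ⟨p, q⟩
  rw [MonoidHom.mem_ker]
  constructor
  · intro h
    have h1 : ∀ u, p * u * q⁻¹ = u := fun u => Equiv.Perm.congr_fun h u
    have h2 : p = q := by simpa [mul_inv_eq_one] using h1 1
    subst h2
    exact ⟨p, Subgroup.mem_center_iff.mpr fun g => (mul_inv_eq_iff_eq_mul.mp (h1 g)).symm, rfl⟩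
  · rintro ⟨z, hz, h⟩
    obtain ⟨rfl, rfl⟩ := Prod.mk.inj h
    ext u
    have := Subgroup.mem_center_iff.mp hz u
    simp [← this]

/-- The action of the central square of `G` on `G` by left and right multiplication. -/
def toPerm (G : Type*) [Group G] : CentralSquare G →* Equiv.Perm G :=
  QuotientGroup.lift (diagonalCenter G) (leftRight G) ker_leftRight.ge

theorem toPerm_mk (p : G × G) : toPerm G (QuotientGroup.mk p) = leftRight G p := rfl

theorem toPerm_injective : Function.Injective (toPerm G) := by
  rw [injective_iff_map_eq_one]
  intro c
  induction c using QuotientGroup.induction_on with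
  | H p =>
    intro h
    rw [toPerm_mk] at h
    rw [QuotientGroup.eq_one_iff, ← ker_leftRight]
    exact h

end CentralSquare

/-! ### Orders of subgroups of a direct product -/

theorem Subgroup.card_le_card_comap_inl_mul {G K : Type*} [Group G] [Group K] [Finite G]
    [Finite K] (H : Subgroup (G × K)) :
    Nat.card H ≤ Nat.card (H.comap (MonoidHom.inl G K)) * Nat.card (H.map (MonoidHom.snd G K)) := by
  set f := (MonoidHom.snd G K).comp H.subtype with hf
  have h1 : f.range = H.map (MonoidHom.snd G K) := by
    rw [hf, MonoidHom.range_comp, Subgroup.range_subtype]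
  rw [← f.ker.card_mul_index, Subgroup.index_ker, h1]
  have h2 : ∀ x : f.ker, (x : H).1.2 = 1 := fun x => x.2
  refine Nat.mul_le_mul_right _ (Nat.card_le_card_of_injective
    (fun x : f.ker => (⟨(x : H).1.1, ?_⟩ : H.comap (MonoidHom.inl G K))) ?_)
  · have := (x : H).2
    rwa [← Prod.mk.eta (p := (x : H).1), h2 x] at this
  · intro x y hxy
    have h3 : (x : H).1.1 = (y : H).1.1 := congrArg Subtype.val hxy
    exact Subtype.ext (Subtype.ext (Prod.ext h3 ((h2 x).trans (h2 y).symm)))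

theorem Subgroup.card_le_card_comap_inr_mul {G K : Type*} [Group G] [Group K] [Finite G]
    [Finite K] (H : Subgroup (G × K)) :
    Nat.card H ≤ Nat.card (H.comap (MonoidHom.inr G K)) * Nat.card (H.map (MonoidHom.fst G K)) := by
  set f := (MonoidHom.fst G K).comp H.subtype with hf
  have h1 : f.range = H.map (MonoidHom.fst G K) := by
    rw [hf, MonoidHom.range_comp, Subgroup.range_subtype]
  rw [← f.ker.card_mul_index, Subgroup.index_ker, h1]
  have h2 : ∀ x : f.ker, (x : H).1.1 = 1 := fun x => x.2
  refine Nat.mul_le_mul_right _ (Nat.card_le_card_of_injective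
    (fun x : f.ker => (⟨(x : H).1.2, ?_⟩ : H.comap (MonoidHom.inr G K))) ?_)
  · have := (x : H).2
    rwa [← Prod.mk.eta (p := (x : H).1), h2 x] at this
  · intro x y hxy
    have h3 : (x : H).1.2 = (y : H).1.2 := congrArg Subtype.val hxy
    exact Subtype.ext (Subtype.ext (Prod.ext ((h2 x).trans (h2 y).symm) h3))

/-! ### The central square of the binary icosahedral group -/

namespace BinaryIcosahedral

/-- The central square of the binary icosahedral group. -/
local notation "CS" => CentralSquare binaryIcosahedral

theorem mem_diagonalCenter {a b : binaryIcosahedral} :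
    (a, b) ∈ diagonalCenter binaryIcosahedral ↔ a = b ∧ (a = 1 ∨ a = negOne) := by
  constructor
  · rintro ⟨z, hz, h⟩
    obtain ⟨rfl, rfl⟩ := Prod.mk.inj h
    exact ⟨rfl, mem_center_iff.mp hz⟩
  · rintro ⟨rfl, h⟩
    exact ⟨a, mem_center_iff.mpr h, rfl⟩

/-- The nontrivial central element of the central square. -/
noncomputable def centralElement : CS := QuotientGroup.mk (negOne, 1)

theorem mk_one_negOne : (QuotientGroup.mk (1, negOne) : CS) = centralElement := by
  refine QuotientGroup.eq.mpr ?_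
  have : ((1, negOne) : binaryIcosahedral × binaryIcosahedral)⁻¹ * (negOne, 1) =
      (negOne, negOne⁻¹) := by simp
  rw [this, inv_eq_of_mul_eq_one_left negOne_mul_self]
  exact mem_diagonalCenter.mpr ⟨rfl, Or.inr rfl⟩

theorem centralElement_ne_one : centralElement ≠ 1 := fun h =>
  negOne_ne_one (mem_diagonalCenter.mp ((QuotientGroup.eq_one_iff _).mp h)).1

theorem centralElement_mul_self : centralElement * centralElement = 1 := by
  rw [centralElement, ← QuotientGroup.mk_mul, Prod.mk_mul_mk, negOne_mul_self, one_mul]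
  rfl

theorem centralElement_mem_center : centralElement ∈ Subgroup.center CS := by
  rw [Subgroup.mem_center_iff]
  intro c
  induction c using QuotientGroup.induction_on with
  | H p =>
    rw [centralElement, ← QuotientGroup.mk_mul, ← QuotientGroup.mk_mul]
    congr 1
    ext1 <;> simp [negOne_comm]

/-- The extreme case is H ∩ (I × 1) trivial; otherwise |H| ≤ 5 · 20. Containing the diagonal centre
makes (1, -1) ∉ H follow from (-1, 1) ∉ H. -/
theorem card_le_of_notMem {H : Subgroup (binaryIcosahedral × binaryIcosahedral)}
    (hH : diagonalCenter binaryIcosahedral ≤ H) (hz : (negOne, 1) ∉ H) : Nat.card H ≤ 120 := by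
  have hz' : (1, negOne) ∉ H := fun h => hz (by
    have := mul_mem h (hH (mem_diagonalCenter.mpr ⟨rfl, Or.inr rfl⟩ : (negOne, negOne) ∈ _))
    rwa [Prod.mk_mul_mk, negOne_mul_self, one_mul] at this)
  by_cases h1 : H.comap (MonoidHom.inl _ _) = ⊥
  · refine H.card_le_card_comap_inl_mul.trans ?_
    rw [h1, Subgroup.card_bot, one_mul, ← card_binaryIcosahedral]
    exact Subgroup.card_le_card_group _
  · have hP : Nat.card (H.map (MonoidHom.fst _ _)) ≤ 20 := by
      refine card_le_twenty_of_normalizes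
        (S := H.comap (MonoidHom.inl binaryIcosahedral binaryIcosahedral)) hz h1 ?_
      rintro _ ⟨⟨p, q⟩, hpq, rfl⟩ x hx
      have := mul_mem (mul_mem hpq hx) (inv_mem hpq)
      simpa using this
    have hL : Nat.card (H.comap (MonoidHom.inr binaryIcosahedral binaryIcosahedral)) ≤ 5 := by
      by_cases h2 : H.comap (MonoidHom.inr binaryIcosahedral binaryIcosahedral) = ⊥
      · rw [h2, Subgroup.card_bot]; norm_num
      · exact (card_le_five_and_traceCount_le_two hz' h2).1
    exact H.card_le_card_comap_inr_mul.trans ((Nat.mul_le_mul hL hP).trans (by norm_num))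

theorem le_index_of_notMem {L : Subgroup CS} (hL : centralElement ∉ L) : 120 ≤ L.index := by
  have h1 := card_le_of_notMem (H := L.comap (QuotientGroup.mk' _))
    (fun x hx => by
      rw [Subgroup.mem_comap, QuotientGroup.mk'_apply, (QuotientGroup.eq_one_iff x).mpr hx]
      exact one_mem L) hL
  have h2 := (L.comap (QuotientGroup.mk' (diagonalCenter binaryIcosahedral))).card_mul_index
  rw [L.index_comap_of_surjective (QuotientGroup.mk'_surjective _), Nat.card_prod,
    card_binaryIcosahedral] at h2
  by_contra! h3
  have := Nat.mul_le_mul h1 (Nat.le_of_lt_succ h3 : L.index ≤ 119)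
  omega

theorem exists_commutator_ne_one {a : binaryIcosahedral} (h : ¬ (a = 1 ∨ a = negOne)) :
    ∃ g, a * g * a⁻¹ * g⁻¹ ≠ 1 := by
  rw [← mem_center_iff, Subgroup.mem_center_iff] at h
  push Not at h
  obtain ⟨g, hg⟩ := h
  refine ⟨g, fun h1 => hg ?_⟩
  rw [mul_inv_eq_one, mul_inv_eq_iff_eq_mul] at h1
  exact h1.symm

/-- If (a, b) lies in the preimage and a is not central, commutators with (g, 1) give a nontrivial
normal subgroup of the first factor, which contains -1; likewise for b. If both are central, (a, b)
itself represents the central involution. -/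
theorem centralElement_mem_of_normal {K : Subgroup CS} (hK : K.Normal) (hK' : K ≠ ⊥) :
    centralElement ∈ K := by
  obtain ⟨c, hc, hc1⟩ := K.bot_or_exists_ne_one.resolve_left hK'
  obtain ⟨⟨a, b⟩, rfl⟩ := QuotientGroup.mk_surjective c
  set H := K.comap (QuotientGroup.mk' (diagonalCenter binaryIcosahedral)) with hH
  have hHn : H.Normal := hK.comap _
  have hab : (a, b) ∈ H := hc
  by_cases ha : a = 1 ∨ a = negOne
  · by_cases hb : b = 1 ∨ b = negOne
    · rcases ha with rfl | rfl <;> rcases hb with rfl | rfl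
      · exact absurd rfl hc1
      · exact mk_one_negOne ▸ hc
      · exact hc
      · exact absurd ((QuotientGroup.eq_one_iff _).mpr
          (mem_diagonalCenter.mpr ⟨rfl, Or.inr rfl⟩)) hc1
    · obtain ⟨g, hg⟩ := exists_commutator_ne_one hb
      have h1 : b * g * b⁻¹ * g⁻¹ ∈ H.comap (MonoidHom.inr _ _) := by
        have := mul_mem hab (hHn.conj_mem _ (inv_mem hab) (1, g))
        simpa [mul_assoc] using this
      have h2 := negOne_mem_of_normal (hHn.comap (MonoidHom.inr binaryIcosahedral _))
        fun h => hg (by rwa [h, Subgroup.mem_bot] at h1)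
      exact mk_one_negOne ▸ (h2 : (1, negOne) ∈ H)
  · obtain ⟨g, hg⟩ := exists_commutator_ne_one ha
    have h1 : a * g * a⁻¹ * g⁻¹ ∈ H.comap (MonoidHom.inl _ _) := by
      have := mul_mem hab (hHn.conj_mem _ (inv_mem hab) (g, 1))
      simpa [mul_assoc] using this
    exact negOne_mem_of_normal (hHn.comap (MonoidHom.inl _ binaryIcosahedral))
      fun h => hg (by rwa [h, Subgroup.mem_bot] at h1)

theorem zpowers_centralElement_normal : (Subgroup.zpowers centralElement).Normal := by
  refine ⟨fun n hn g => ?_⟩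
  have : n ∈ Subgroup.center CS :=
    (Subgroup.zpowers_le.mpr centralElement_mem_center) hn
  rw [Subgroup.mem_center_iff.mp this g, mul_inv_cancel_right]
  exact hn

theorem zpowers_centralElement_ne_bot : Subgroup.zpowers centralElement ≠ ⊥ :=
  fun h => centralElement_ne_one (Subgroup.zpowers_eq_bot.mp h)

theorem exists_unique_minimal_normal :
    ∃ N : Subgroup CS, IsMinimalNormal N ∧ Nonempty (N ≃* Multiplicative (ZMod 2)) ∧
      ∀ K : Subgroup CS, IsMinimalNormal K → K = N := by
  have hle : ∀ K : Subgroup CS, K.Normal ∧ K ≠ ⊥ → Subgroup.zpowers centralElement ≤ K :=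
    fun K hK => Subgroup.zpowers_le.mpr (centralElement_mem_of_normal hK.1 hK.2)
  have hN := And.intro zpowers_centralElement_normal zpowers_centralElement_ne_bot
  refine ⟨Subgroup.zpowers centralElement, ⟨hN, fun K hK _ => hle K hK⟩, ?_,
    fun K hK => le_antisymm (hK.2 hN (hle K hK.1)) (hle K hK.1)⟩
  have h2 : Nat.card (Subgroup.zpowers centralElement) = 2 := by
    rw [Nat.card_zpowers]
    exact orderOf_eq_prime (by rw [pow_two, centralElement_mul_self]) centralElement_ne_one
  exact ⟨mulEquivOfPrimeCardEq (p := 2) h2 (by simp)⟩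

/-! ### Orbits of faithful actions and core-free subgroups -/

theorem exists_large_orbit {X : Type*} (f : CS →* Equiv.Perm X)
    (hf : Function.Injective f) : ∃ x, 120 ≤ (Set.range fun g => f g x).ncard := by
  obtain ⟨x, hx⟩ : ∃ x, f centralElement x ≠ x := by
    by_contra! h
    exact centralElement_ne_one (hf (by rw [map_one]; ext x; exact h x))
  let _ : MulAction CS X := MulAction.compHom X f
  have h1 := MulAction.index_stabilizer CS x
  have h2 := le_index_of_notMem (L := MulAction.stabilizer CS x) hx
  exact ⟨x, h2.trans h1.le⟩

instance : Finite CS := Quotient.finite _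

theorem minimalDegree_centralSquare : minimalDegree CS = 120 := by
  refine le_antisymm ?_ ?_
  · rw [← card_binaryIcosahedral]
    exact minimalDegree_le_card _ CentralSquare.toPerm_injective
  · obtain ⟨f, hf⟩ := exists_injective_minimalDegree CS
    obtain ⟨x, hx⟩ := exists_large_orbit f hf
    exact hx.trans ((Set.ncard_le_card _).trans (by simp))

theorem transitive_of_injective {n : ℕ} (hn : n = 120) (f : CS →* Equiv.Perm (Fin n))
    (hf : Function.Injective f) (x y : Fin n) : ∃ g, f g x = y := by
  obtain ⟨x₀, hx₀⟩ := exists_large_orbit f hf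
  have h1 : (Set.range fun g => f g x₀) = Set.univ :=
    Set.eq_of_subset_of_ncard_le (Set.subset_univ _) (by simpa [Set.ncard_univ, hn] using hx₀)
  obtain ⟨a, ha⟩ := h1.ge (Set.mem_univ x)
  obtain ⟨b, hb⟩ := h1.ge (Set.mem_univ y)
  refine ⟨b * a⁻¹, ?_⟩
  rw [← ha, ← hb, ← Equiv.Perm.mul_apply, ← map_mul, inv_mul_cancel_right]

/-- The witness is the stabilizer of 1 under left and right multiplication: a nontrivial core would
contain the central involution, which sends 1 to -1. -/
theorem isLeast_index_core_free :
    IsLeast {n : ℕ | ∃ L : Subgroup CS, L.normalCore = ⊥ ∧ L.index = n} 120 := by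
  constructor
  · let _ : MulAction CS binaryIcosahedral :=
      MulAction.compHom binaryIcosahedral (CentralSquare.toPerm binaryIcosahedral)
    have hsmul : ∀ p : binaryIcosahedral × binaryIcosahedral,
        (QuotientGroup.mk p : CS) • (1 : binaryIcosahedral) = p.1 * 1 * p.2⁻¹ := fun p => rfl
    refine ⟨MulAction.stabilizer CS (1 : binaryIcosahedral), ?_, ?_⟩
    · by_contra h
      have h1 := Subgroup.normalCore_le _
        (centralElement_mem_of_normal (Subgroup.normalCore_normal _) h)
      rw [MulAction.mem_stabilizer_iff, centralElement, hsmul] at h1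
      exact negOne_ne_one (by simpa using h1)
    · have h1 : MulAction.orbit CS (1 : binaryIcosahedral) = Set.univ :=
        Set.eq_univ_of_forall fun u => ⟨QuotientGroup.mk (u, 1), by
          change (QuotientGroup.mk (u, 1) : CS) • (1 : binaryIcosahedral) = u
          rw [hsmul]; simp⟩
      rw [MulAction.index_stabilizer, h1, Set.ncard_univ, card_binaryIcosahedral]
  · rintro n ⟨L, hL, rfl⟩
    refine le_index_of_notMem fun h => zpowers_centralElement_ne_bot ?_
    have := zpowers_centralElement_normal
    exact le_bot_iff.mp (hL ▸ Subgroup.normal_le_normalCore.mpr (Subgroup.zpowers_le.mpr h))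

end BinaryIcosahedral

/-! ### Descending along a dihedral parabolic subgroup -/

namespace CoxeterSystem

variable {B W : Type*} [Group W] {M : CoxeterMatrix B} (cs : CoxeterSystem M W)

theorem exists_alternatingWord_not_isRightDescent {w : W} {s t : B} (hM : M s t ≠ 0)
    (hs : ¬ cs.IsRightDescent w s) (ht : cs.IsRightDescent w t) :
    ∃ k < M s t, ∃ v : W, cs.length v < cs.length w ∧
      w = v * cs.wordProd (alternatingWord s t k) ∧
      ¬ cs.IsRightDescent v s ∧ ¬ cs.IsRightDescent v t := by
  classical
  set u : ℕ → W := fun k => cs.wordProd (alternatingWord s t k) with hu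
  set x : ℕ → B := fun k => if Even k then t else s with hx
  have hu0 : u 0 = 1 := by simp [hu, alternatingWord]
  have hstep : ∀ k, w * (u (k + 1))⁻¹ = w * (u k)⁻¹ * cs.simple (x k) := by
    intro k
    simp only [hu, hx]
    rw [alternatingWord_succ', wordProd_cons, mul_inv_rev, inv_simple, mul_assoc]
  have hback : ∀ k, w * (u k)⁻¹ = w * (u (k + 1))⁻¹ * cs.simple (x k) := by
    intro k
    rw [hstep, mul_assoc _ (cs.simple _), cs.simple_mul_simple_self, mul_one]
  let Q : ℕ → Prop := fun k => cs.length (w * (u k)⁻¹) + k = cs.length w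
  have hQ0 : Q 0 := by simp [Q, hu0]
  have hex : ∃ k, ¬ Q (k + 1) := ⟨cs.length w, fun h => by simp only [Q] at h; omega⟩
  set k := Nat.find hex with hk
  have hmin : ∀ j < k, Q (j + 1) := fun j hj => not_not.mp (Nat.find_min hex hj)
  have hnot : ¬ Q (k + 1) := Nat.find_spec hex
  have hQ : ∀ j ≤ k, Q j := by
    intro j hj
    rcases j with _ | j
    · exact hQ0
    · exact hmin j hj
  have hkpos : k ≠ 0 := by
    intro h0
    rw [h0] at hnot
    apply hnot
    simp only [Q]
    rw [hstep 0, hu0, inv_one, mul_one]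
    exact (cs.isRightDescent_iff.mp ht)
  obtain ⟨l, hl⟩ := Nat.exists_eq_succ_of_ne_zero hkpos
  have hQk : cs.length (w * (u k)⁻¹) + k = cs.length w := hQ k le_rfl
  have hQl : cs.length (w * (u l)⁻¹) + l = cs.length w := hQ l (by omega)
  have hd1 : ¬ cs.IsRightDescent (w * (u k)⁻¹) (x k) := by
    intro h
    apply hnot
    have := cs.isRightDescent_iff.mp h
    simp only [Q]
    rw [hstep k]
    omega
  have hd2 : ¬ cs.IsRightDescent (w * (u k)⁻¹) (x l) := by
    intro h
    have h1 := cs.isRightDescent_iff.mp h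
    rw [hl, Nat.succ_eq_add_one, ← hback l] at h1
    rw [hl, Nat.succ_eq_add_one] at hQk
    omega
  refine ⟨k, ?_, w * (u k)⁻¹, by omega, by simp [hu], ?_⟩
  -- If `M s t` letters could be stripped, the braid relation would rewrite the stripped word to end
  -- in s, making s a right descent of w.
  · by_contra! hle
    have hQm : cs.length (w * (u (M s t))⁻¹) + M s t = cs.length w := hQ _ hle
    obtain ⟨m, hm⟩ := Nat.exists_eq_succ_of_ne_zero hM
    have h1 : u (M s t) = u m * cs.simple s := by
      have h2 : u (M s t) = cs.wordProd (alternatingWord t s (M s t)) := by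
        have h3 := cs.wordProd_braidWord_eq s t
        rw [braidWord, braidWord, M.symmetric t s] at h3
        exact h3
      rw [h2, hm, Nat.succ_eq_add_one, alternatingWord_succ, wordProd_concat]
    have h2 : w * cs.simple s = w * (u (M s t))⁻¹ * u m := by
      rw [h1, mul_inv_rev, inv_simple]; group
    have h3 := cs.length_mul_le (w * (u (M s t))⁻¹) (u m)
    have h4 : cs.length (u m) ≤ m := by
      have := cs.length_wordProd_le (alternatingWord s t m)
      rwa [length_alternatingWord] at this
    have h5 := cs.not_isRightDescent_iff.mp hs
    rw [h2] at h5
    omega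
  · rcases Nat.even_or_odd l with he | ho
    · have h1 : x l = t := by simp [hx, he]
      have h2 : x k = s := by simp [hx, hl, Nat.even_add_one, he]
      exact ⟨h2 ▸ hd1, h1 ▸ hd2⟩
    · have h1 : x l = s := by simp [hx, Nat.not_even_iff_odd.mpr ho]
      have h2 : x k = t := by simp [hx, hl, Nat.even_add_one, Nat.not_even_iff_odd.mpr ho]
      exact ⟨h1 ▸ hd2, h2 ▸ hd1⟩

end CoxeterSystem

namespace BinaryIcosahedral

open HalfIcosian

/-! ### Elements given by coordinates -/

/-- The element of the binary icosahedral group with given doubled coordinates. -/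
noncomputable def ofCoords (x : HalfIcosian) (hx : x ∈ elements) : binaryIcosahedral :=
  ⟨(represents_of_mem_elements x hx).choose, (represents_of_mem_elements x hx).choose_spec.1⟩

theorem toQuat_ofCoords {x : HalfIcosian} (hx : x ∈ elements) :
    toQuat (ofCoords x hx) = toQuaternion x :=
  (represents_of_mem_elements x hx).choose_spec.2

theorem ofCoords_mul {x y : HalfIcosian} (hx : x ∈ elements) (hy : y ∈ elements)
    (h : Exact x y) (hxy : mul x y ∈ elements) :
    ofCoords x hx * ofCoords y hy = ofCoords (mul x y) hxy :=
  toQuat_injective (by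
    rw [map_mul, toQuat_ofCoords, toQuat_ofCoords, toQuat_ofCoords, toQuaternion_mul h])

theorem ofCoords_inv {x : HalfIcosian} (hx : x ∈ elements) (hx' : conj x ∈ elements) :
    (ofCoords x hx)⁻¹ = ofCoords (conj x) hx' :=
  toQuat_injective (by rw [toQuat_inv, toQuat_ofCoords, toQuat_ofCoords, toQuaternion_conj])

theorem trace_ofCoords {x : HalfIcosian} (hx : x ∈ elements) : trace (ofCoords x hx) = x.1 := by
  apply goldenReal_injective
  rw [goldenReal_trace, toQuat_ofCoords, re_toQuaternion]
  ring

theorem ofCoords_one (h : one ∈ elements) : ofCoords one h = 1 :=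
  toQuat_injective (by rw [toQuat_ofCoords, toQuaternion_one, map_one])

theorem eq_top_of_gens_mem {K : Subgroup binaryIcosahedral} (hA : genA ∈ elements)
    (hB : genB ∈ elements) (h1 : ofCoords genA hA ∈ K) (h2 : ofCoords genB hB ∈ K) : K = ⊤ := by
  refine top_le_iff.mp ?_
  have h := Subgroup.closure_closure_coe_preimage (k := {u : ℍ[ℝ]ˣ |
    (u : ℍ[ℝ]) = ⟨1 / 2, 1 / 2, 1 / 2, 1 / 2⟩ ∨
    (u : ℍ[ℝ]) = ⟨Real.goldenRatio / 2, Real.goldenRatio⁻¹ / 2, 1 / 2, 0⟩})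
  change _ = (⊤ : Subgroup binaryIcosahedral) at h
  rw [← h]
  refine (Subgroup.closure_le _).mpr ?_
  rintro u (hu | hu)
  · have : u = ofCoords genA hA := toQuat_injective (by
      rw [toQuat_ofCoords, toQuaternion_genA]; exact hu)
    rwa [this]
  · have : u = ofCoords genB hB := toQuat_injective (by
      rw [toQuat_ofCoords, toQuaternion_genB]; exact hu)
    rwa [this]

theorem toQuat_add_toQuat_inv (x : binaryIcosahedral) :
    toQuat x + toQuat x⁻¹ = goldenReal (trace x) • (1 : ℍ[ℝ]) := by
  rw [toQuat_inv, goldenReal_trace]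
  ext <;> simp; ring

/-- The quaternion -x has trace 1, so (-x)³ = -1. Order 5 is treated in the same way. -/
theorem pow_three_of_trace {x : binaryIcosahedral} (h : trace x = (-1, 0)) : x ^ 3 = 1 := by
  have h1 := toQuat_mul_self x
  have h2 := pow_three_eq_neg_one (q := -toQuat x) (by
    rw [neg_mul_neg, h1, h]; simp [goldenReal])
  rw [Odd.neg_pow (by decide), neg_inj] at h2
  exact toQuat_injective (by rw [map_pow, h2, map_one])

theorem pow_five_of_trace {x : binaryIcosahedral} (h : trace x = (0, -1) ∨ trace x = (-1, 1)) :
    x ^ 5 = 1 := by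
  have h1 := toQuat_mul_self x
  have h2 : (-toQuat x) ^ 5 = -1 := by
    rcases h with h | h
    · refine pow_five_eq_neg_one Real.goldenRatio_sq ?_
      rw [neg_mul_neg, h1, h]; simp [goldenReal]
    · refine pow_five_eq_neg_one goldenConj_sq' ?_
      rw [neg_mul_neg, h1, h, smul_neg, ← neg_smul]; simp [goldenReal, add_comm, sub_eq_add_neg]
  rw [Odd.neg_pow (by decide), neg_inj] at h2
  exact toQuat_injective (by rw [map_pow, h2, map_one])

theorem sq_of_trace {x : binaryIcosahedral} (h : trace x = (0, 0)) : x ^ 2 = negOne := by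
  have h1 := toQuat_mul_self x
  exact toQuat_injective (by rw [map_pow, pow_two, h1, h, toQuat_negOne]; simp [goldenReal])

/-! ### Reflections -/

/-- The reflection `u ↦ - r u⁻¹ r` in the root `r`, as a permutation of the group. -/
noncomputable def reflectionPerm (r : binaryIcosahedral) : Equiv.Perm binaryIcosahedral :=
  (Equiv.inv _).trans (CentralSquare.leftRight _ (negOne * r, r⁻¹))

theorem reflectionPerm_apply (r u : binaryIcosahedral) :
    reflectionPerm r u = negOne * (r * u⁻¹ * r) := by
  simp [reflectionPerm, mul_assoc]

/-- The two inversions and the two signs cancel, so products of two reflections come from the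
central square. -/
theorem reflectionPerm_mul (a b : binaryIcosahedral) :
    reflectionPerm a * reflectionPerm b = CentralSquare.leftRight _ (a * b⁻¹, a⁻¹ * b) := by
  ext1 u
  have h : negOne⁻¹ = negOne := inv_eq_of_mul_eq_one_left negOne_mul_self
  rw [Equiv.Perm.mul_apply, reflectionPerm_apply, reflectionPerm_apply,
    CentralSquare.leftRight_apply, mul_inv_rev negOne, h, ← negOne_comm, ← mul_assoc a,
    ← negOne_comm a]
  simp only [← mul_assoc, negOne_mul_self, one_mul, mul_inv_rev, inv_inv]

/-- The reflection `x ↦ - r x̄ r` in the unit quaternion `r`, as a linear map. -/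
noncomputable def reflectionLinear (r : binaryIcosahedral) : Module.End ℝ ℍ[ℝ] where
  toFun x := -(toQuat r * star x * toQuat r)
  map_add' x y := by rw [star_add, mul_add, add_mul, neg_add]
  map_smul' c x := by simp

theorem reflectionLinear_toQuat (r u : binaryIcosahedral) :
    reflectionLinear r (toQuat u) = toQuat (reflectionPerm r u) := by
  rw [reflectionPerm_apply]
  simp [reflectionLinear, toQuat_negOne, toQuat_inv]

/-- The trace of a b⁻¹ is twice the inner product of the unit quaternions a and b, so this is the
usual formula for a reflection. -/
theorem reflectionLinear_eq_add (a b : binaryIcosahedral) :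
    reflectionLinear a (toQuat b) = toQuat b - goldenReal (trace (a * b⁻¹)) • toQuat a := by
  have h := congrArg (· * toQuat a) (toQuat_add_toQuat_inv (a * b⁻¹))
  simp only [add_mul, smul_mul_assoc, one_mul, ← map_mul] at h
  rw [← h, reflectionLinear_toQuat, reflectionPerm_apply, map_mul, toQuat_negOne]
  simp

theorem end_ext {f g : Module.End ℝ ℍ[ℝ]} (h : ∀ u, f (toQuat u) = g (toQuat u)) : f = g := by
  obtain ⟨i, hi, hi'⟩ := represents_unitI
  obtain ⟨j, hj, hj'⟩ := represents_unitJ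
  let i' : binaryIcosahedral := ⟨i, hi⟩
  let j' : binaryIcosahedral := ⟨j, hj⟩
  have hi1 : toQuat i' = toQuaternion unitI := hi'
  have hj1 : toQuat j' = toQuaternion unitJ := hj'
  ext1 x
  have hx : x = x.re • toQuat 1 + x.imI • toQuat i' + x.imJ • toQuat j' +
      x.imK • toQuat (i' * j') := by
    rw [map_one, map_mul, hi1, hj1]
    ext <;> simp [re_toQuaternion, imI_toQuaternion, imJ_toQuaternion, imK_toQuaternion,
      unitI, unitJ, goldenReal]
  rw [hx]
  simp only [map_add, map_smul, h]

end BinaryIcosahedral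

namespace BinaryIcosahedral

open HalfIcosian

/-! ### The Coxeter group of type `H₄` -/

/-- The coordinates of a system of simple roots of type `H₄`. -/
def rootCoords : Fin 4 → HalfIcosian
  | 0 => ((0, 0), (0, 0), (-2, 0), (0, 0))
  | 1 => ((0, 0), (0, 1), (1, 0), (1, -1))
  | 2 => ((0, -1), (-1, 0), (0, 0), (-1, 1))
  | 3 => one

theorem rootCoords_mem : ∀ i, rootCoords i ∈ elements := by decide +kernel

/-- A system of simple roots of type `H₄` in the binary icosahedral group. -/
noncomputable def root (i : Fin 4) : binaryIcosahedral := ofCoords (rootCoords i) (rootCoords_mem i)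

theorem root_three : root 3 = 1 := ofCoords_one _

theorem toQuat_root (i : Fin 4) : toQuat (root i) = toQuaternion (rootCoords i) :=
  toQuat_ofCoords _

/-- The doubled inner products `- 2 cos (π / m)` of two simple roots, in terms of `m`. -/
def gram : ℕ → GoldenInt
  | 1 => (2, 0)
  | 2 => (0, 0)
  | 3 => (-1, 0)
  -- Only m = 5 is used here: 2 cos (π / 5) = φ.
  | _ => (0, -1)

theorem conj_rootCoords_mem : ∀ i, conj (rootCoords i) ∈ elements := by decide +kernel

theorem rootCoords_mul_conj : ∀ i j, Exact (rootCoords i) (conj (rootCoords j)) ∧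
    mul (rootCoords i) (conj (rootCoords j)) ∈ elements ∧
    (mul (rootCoords i) (conj (rootCoords j))).1 = gram (CoxeterMatrix.H₄ i j) := by
  decide +kernel

theorem trace_root_mul_inv (i j : Fin 4) :
    trace (root i * (root j)⁻¹) = gram (CoxeterMatrix.H₄ i j) := by
  obtain ⟨h1, h2, h3⟩ := rootCoords_mul_conj i j
  rw [root, root, ofCoords_inv _ (conj_rootCoords_mem j), ofCoords_mul _ _ h1 h2,
    trace_ofCoords, h3]

theorem H₄_cases (i j : Fin 4) : CoxeterMatrix.H₄ i j = 1 ∨ CoxeterMatrix.H₄ i j = 2 ∨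
    CoxeterMatrix.H₄ i j = 3 ∨ CoxeterMatrix.H₄ i j = 5 := by
  fin_cases i <;> fin_cases j <;> simp [CoxeterMatrix.H₄]

theorem pow_eq_one_or_eq_negOne {x : binaryIcosahedral} {m : ℕ} (hx : trace x = gram m)
    (hm : m = 1 ∨ m = 2 ∨ m = 3 ∨ m = 5) : x ^ m = 1 ∨ x ^ m = negOne := by
  rcases hm with rfl | rfl | rfl | rfl
  · exact Or.inl (by rw [pow_one, eq_one_of_trace hx])
  · exact Or.inr (sq_of_trace hx)
  · exact Or.inl (pow_three_of_trace hx)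
  · exact Or.inl (pow_five_of_trace (Or.inl hx))

/-- For a = `root i` and b = `root j`, the m-th power of the product is left-right multiplication by
(a b⁻¹)^m and (a⁻¹ b)^m. The first is ±1 by its trace; the second is conjugate to the inverse of the
first, hence equal to it, and such a pair acts trivially. -/
theorem reflectionPerm_liftable :
    CoxeterMatrix.H₄.IsLiftable fun i => reflectionPerm (root i) := by
  intro i j
  set m := CoxeterMatrix.H₄ i j
  have h := pow_eq_one_or_eq_negOne (trace_root_mul_inv i j) (H₄_cases i j)
  rw [reflectionPerm_mul, ← map_pow, ← MonoidHom.mem_ker, CentralSquare.ker_leftRight,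
    Prod.pow_mk, mem_diagonalCenter]
  refine ⟨?_, h⟩
  have h1 : (root i)⁻¹ * root j = (root j)⁻¹ * (root i * (root j)⁻¹)⁻¹ * root j := by group
  have h2 : negOne⁻¹ = negOne := inv_eq_of_mul_eq_one_left negOne_mul_self
  have h3 : ((root j)⁻¹ * (root i * (root j)⁻¹)⁻¹ * root j) ^ m =
      (root j)⁻¹ * ((root i * (root j)⁻¹) ^ m)⁻¹ * root j := by
    have := conj_pow (i := m) (a := (root j)⁻¹) (b := (root i * (root j)⁻¹)⁻¹)
    rw [inv_inv] at this
    rw [this, inv_pow]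
  rw [h1, h3]
  rcases h with h | h <;> rw [h]
  · simp
  · rw [h2, ← negOne_comm, mul_assoc, inv_mul_cancel, mul_one]

theorem reflectionLinear_liftable :
    CoxeterMatrix.H₄.IsLiftable fun i => reflectionLinear (root i) := by
  intro i j
  have h : ∀ (n : ℕ) u, ((reflectionLinear (root i) * reflectionLinear (root j)) ^ n) (toQuat u) =
      toQuat (((reflectionPerm (root i) * reflectionPerm (root j)) ^ n) u) := by
    intro n
    induction n with
    | zero => intro u; simp
    | succ n ih =>
      intro u
      rw [pow_succ, pow_succ, Module.End.mul_apply, Module.End.mul_apply,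
        reflectionLinear_toQuat, reflectionLinear_toQuat, ih]
      rfl
  refine end_ext fun u => ?_
  rw [h, reflectionPerm_liftable i j]
  rfl

/-! ### The permutation and linear representations of W(H₄) -/

/-- The Coxeter system of type `H₄`. -/
abbrev coxeterH₄ : CoxeterSystem CoxeterMatrix.H₄ CoxeterMatrix.H₄.Group :=
  CoxeterMatrix.H₄.toCoxeterSystem

/-- The action of the Coxeter group on the binary icosahedral group, seen as a root system. -/
noncomputable def permRep : CoxeterMatrix.H₄.Group →* Equiv.Perm binaryIcosahedral :=
  coxeterH₄.lift ⟨_, reflectionPerm_liftable⟩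

/-- The geometric representation of the Coxeter group on the quaternions. -/
noncomputable def linearRep : CoxeterMatrix.H₄.Group →* Module.End ℝ ℍ[ℝ] :=
  coxeterH₄.lift ⟨_, reflectionLinear_liftable⟩

theorem permRep_simple (i : Fin 4) : permRep (coxeterH₄.simple i) = reflectionPerm (root i) :=
  coxeterH₄.lift_apply_simple reflectionPerm_liftable i

theorem linearRep_simple (i : Fin 4) :
    linearRep (coxeterH₄.simple i) = reflectionLinear (root i) :=
  coxeterH₄.lift_apply_simple reflectionLinear_liftable i

theorem linearRep_toQuat (w : CoxeterMatrix.H₄.Group) :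
    ∀ u, linearRep w (toQuat u) = toQuat (permRep w u) := by
  induction w using coxeterH₄.simple_induction_left with
  | one => intro u; simp
  | mul_simple_left w i ih =>
    intro u
    rw [map_mul, map_mul, Module.End.mul_apply, ih, linearRep_simple, permRep_simple,
      reflectionLinear_toQuat, Equiv.Perm.mul_apply]

theorem linearRep_simple_root_self (s : Fin 4) :
    linearRep (coxeterH₄.simple s) (toQuat (root s)) = -toQuat (root s) := by
  rw [linearRep_simple, reflectionLinear_toQuat, reflectionPerm_apply]
  simp [toQuat_negOne]

theorem linearRep_simple_combination (s t : Fin 4) (a b : ℝ) :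
    linearRep (coxeterH₄.simple t) (a • toQuat (root s) + b • toQuat (root t)) =
      a • toQuat (root s) +
        (-goldenReal (gram (CoxeterMatrix.H₄ s t)) * a - b) • toQuat (root t) := by
  rw [map_add, map_smul, map_smul, linearRep_simple_root_self, linearRep_simple,
    reflectionLinear_eq_add, trace_root_mul_inv, CoxeterMatrix.H₄.symmetric]
  module

/-! ### Positivity of roots and faithfulness -/

/-- A linear functional which is positive on the simple roots. -/
def height (x : ℍ[ℝ]) : ℝ := x.re + 5 * x.imI - x.imJ + 11 * x.imK

theorem height_combination (a b : ℝ) (x y : ℍ[ℝ]) :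
    height (a • x + b • y) = a * height x + b * height y := by
  simp only [height, Quaternion.re_add, Quaternion.imI_add, Quaternion.imJ_add,
    Quaternion.imK_add, Quaternion.re_smul, Quaternion.imI_smul, Quaternion.imJ_smul,
    Quaternion.imK_smul, smul_eq_mul]
  ring

theorem height_neg (x : ℍ[ℝ]) : height (-x) = -height x := by
  simp only [height, Quaternion.re_neg, Quaternion.imI_neg, Quaternion.imJ_neg,
    Quaternion.imK_neg]
  ring

theorem height_root_pos (i : Fin 4) : 0 < height (toQuat (root i)) := by
  -- The heights of the four roots are 1, 5 - 3φ, 5φ - 8 and 1, which explains both bounds on φ.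
  have h1 : 8 / 5 < φ := by nlinarith [Real.goldenRatio_sq, Real.goldenRatio_pos]
  have h2 : φ < 5 / 3 := by nlinarith [Real.goldenRatio_sq, Real.goldenRatio_pos]
  rw [toQuat_root]
  fin_cases i <;> simp [height, re_toQuaternion, imI_toQuaternion, imJ_toQuaternion,
    imK_toQuaternion, rootCoords, goldenReal, one] <;> linarith

/-- Positivity inside a dihedral parabolic subgroup, by following the coefficients (a, b) letter by
letter. For m = 5 they run through (1, 0), (1, φ), (φ, φ), (φ, 1), (0, 1). -/
theorem exists_combination {s t : Fin 4} (hst : s ≠ t) {k : ℕ}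
    (hk : k < CoxeterMatrix.H₄ s t) : ∃ a b : ℝ, 0 ≤ a ∧ 0 ≤ b ∧ 0 < a + b ∧
      linearRep (coxeterH₄.wordProd (CoxeterSystem.alternatingWord s t k)) (toQuat (root s)) =
        a • toQuat (root s) + b • toQuat (root t) := by
  have hpos := Real.goldenRatio_pos
  have hφ := Real.goldenRatio_sq
  set m := CoxeterMatrix.H₄ s t with hm
  set c := -goldenReal (gram m) with hc
  set R : ℕ → Module.End ℝ ℍ[ℝ] := fun k =>
    linearRep (coxeterH₄.wordProd (CoxeterSystem.alternatingWord s t k)) with hR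
  have h0 : R 0 (toQuat (root s)) = (1 : ℝ) • toQuat (root s) + (0 : ℝ) • toQuat (root t) := by
    simp [hR, CoxeterSystem.alternatingWord]
  have heven : ∀ {k a b}, Even k →
      R k (toQuat (root s)) = a • toQuat (root s) + b • toQuat (root t) →
      R (k + 1) (toQuat (root s)) = a • toQuat (root s) + (c * a - b) • toQuat (root t) := by
    intro k a b he h
    simp only [hR] at h ⊢
    rw [CoxeterSystem.alternatingWord_succ', if_pos he, CoxeterSystem.wordProd_cons, map_mul,
      Module.End.mul_apply, h, linearRep_simple_combination]
  have hodd : ∀ {k a b}, ¬ Even k →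
      R k (toQuat (root s)) = a • toQuat (root s) + b • toQuat (root t) →
      R (k + 1) (toQuat (root s)) = (c * b - a) • toQuat (root s) + b • toQuat (root t) := by
    intro k a b he h
    simp only [hR] at h ⊢
    rw [CoxeterSystem.alternatingWord_succ', if_neg he, CoxeterSystem.wordProd_cons, map_mul,
      Module.End.mul_apply, h, add_comm, linearRep_simple_combination, add_comm,
      CoxeterMatrix.H₄.symmetric]
  have h1 := heven (by decide) h0
  have h2 := hodd (by decide) h1
  have h3 := heven (by decide) h2
  have h4 := hodd (by decide) h3
  have hm1 : m ≠ 1 := CoxeterMatrix.H₄.off_diagonal s t hst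
  change ∃ a b : ℝ, 0 ≤ a ∧ 0 ≤ b ∧ 0 < a + b ∧ R k (toQuat (root s)) = _
  rcases H₄_cases s t with h | h | h | h <;> rw [← hm] at h
  · exact absurd h hm1
  · have hc' : c = 0 := by simp [hc, h, gram, goldenReal]
    rw [h] at hk
    interval_cases k
    · exact ⟨_, _, by norm_num, by norm_num, by norm_num, h0⟩
    · exact ⟨_, _, by norm_num, by norm_num [hc'], by norm_num [hc'], h1⟩
  · have hc' : c = 1 := by simp [hc, h, gram, goldenReal]
    rw [h] at hk
    interval_cases k
    · exact ⟨_, _, by norm_num, by norm_num, by norm_num, h0⟩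
    · exact ⟨_, _, by norm_num, by norm_num [hc'], by norm_num [hc'], h1⟩
    · exact ⟨_, _, by norm_num [hc'], by norm_num [hc'], by norm_num [hc'], h2⟩
  · have hc' : c = φ := by simp [hc, h, gram, goldenReal]
    rw [h] at hk
    rw [hc'] at h1 h2 h3 h4
    have e1 : φ * 1 - 0 = φ := by ring
    have e2 : φ * φ - 1 = φ := by linear_combination hφ
    have e3 : φ * φ - φ = 1 := by linear_combination hφ
    have e4 : φ * 1 - φ = 0 := by ring
    rw [e1] at h1 h2 h3 h4
    rw [e2] at h2 h3 h4
    rw [e3] at h3 h4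
    rw [e4] at h4
    interval_cases k
    · exact ⟨_, _, by norm_num, by norm_num, by norm_num, h0⟩
    · exact ⟨_, _, by norm_num, hpos.le, by positivity, h1⟩
    · exact ⟨_, _, hpos.le, hpos.le, by positivity, h2⟩
    · exact ⟨_, _, hpos.le, by norm_num, by positivity, h3⟩
    · exact ⟨_, _, by norm_num, by norm_num, by norm_num, h4⟩

/-- Induction on length. Take a right descent t of w and write w = v u, with u in ⟨s, t⟩ and v
shorter with neither s nor t as a descent. Then u sends the root of s to a nonnegative combination
of the two roots, on each of which v is positive by induction. -/
theorem height_linearRep_pos : ∀ (n : ℕ) (w : CoxeterMatrix.H₄.Group), coxeterH₄.length w = n →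
    ∀ s, ¬ coxeterH₄.IsRightDescent w s → 0 < height (linearRep w (toQuat (root s))) := by
  intro n
  induction n using Nat.strong_induction_on with
  | _ n ih =>
    rintro w rfl s hs
    by_cases hw : w = 1
    · rw [hw, map_one]
      exact height_root_pos s
    · obtain ⟨t, ht⟩ := coxeterH₄.exists_rightDescent_of_ne_one hw
      have hst : s ≠ t := fun h => hs (h ▸ ht)
      have hM : CoxeterMatrix.H₄ s t ≠ 0 := by
        rcases H₄_cases s t with h | h | h | h <;> omega
      obtain ⟨k, hk, v, hv, rfl, hvs, hvt⟩ :=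
        coxeterH₄.exists_alternatingWord_not_isRightDescent hM hs ht
      obtain ⟨a, b, ha, hb, hab, h⟩ := exists_combination hst hk
      rw [map_mul, Module.End.mul_apply, h, map_add, map_smul, map_smul, height_combination]
      have h1 := ih _ hv v rfl s hvs
      have h2 := ih _ hv v rfl t hvt
      rcases ha.eq_or_lt with rfl | ha
      · have hb' : 0 < b := by linarith
        nlinarith [mul_pos hb' h2]
      · nlinarith [mul_pos ha h1, mul_nonneg hb h2.le]

/-- If w ≠ 1 acted trivially and had right descent s, then w s would send the root of s to its
negative, although s is not a descent of w s. -/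
theorem permRep_injective : Function.Injective permRep := by
  rw [injective_iff_map_eq_one]
  intro w hw
  by_contra hne
  obtain ⟨s, hs⟩ := coxeterH₄.exists_rightDescent_of_ne_one hne
  have h1 := height_linearRep_pos _ (w * coxeterH₄.simple s) rfl s
    (coxeterH₄.isRightDescent_iff_not_isRightDescent_mul.mp hs)
  rw [map_mul, Module.End.mul_apply, linearRep_simple_root_self, map_neg, linearRep_toQuat, hw,
    Equiv.Perm.one_apply, height_neg] at h1
  linarith [height_root_pos s]

end BinaryIcosahedral

namespace BinaryIcosahedral

open HalfIcosian CentralSquare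

/-! ### The rotation subgroup -/

theorem reflectionPerm_mem_range (i : Fin 4) : reflectionPerm (root i) ∈ permRep.range :=
  ⟨_, permRep_simple i⟩

theorem leftRight_root_mem_range (i j : Fin 4) :
    leftRight _ (root i * (root j)⁻¹, (root i)⁻¹ * root j) ∈ permRep.range := by
  rw [← reflectionPerm_mul]
  exact mul_mem (reflectionPerm_mem_range i) (reflectionPerm_mem_range j)

theorem gens_mem : genA ∈ elements ∧ genB ∈ elements ∧ conj genA ∈ elements := by decide +kernel

/-- The elements whose left multiplication is in the image of the Coxeter group. -/
noncomputable def leftSubgroup : Subgroup binaryIcosahedral :=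
  permRep.range.comap ((leftRight _).comp (MonoidHom.inl _ _))

theorem mem_leftSubgroup {g : binaryIcosahedral} :
    g ∈ leftSubgroup ↔ leftRight _ (g, 1) ∈ permRep.range := Iff.rfl

theorem conj_mem_leftSubgroup {g : binaryIcosahedral} (hg : g ∈ leftSubgroup) (i : Fin 4) :
    root i * g * (root i)⁻¹ ∈ leftSubgroup := by
  have h1 := leftRight_root_mem_range i 3
  rw [root_three, inv_one, mul_one, mul_one] at h1
  rw [mem_leftSubgroup] at hg ⊢
  have h2 := mul_mem (mul_mem h1 hg) (inv_mem h1)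
  rw [← map_inv, ← map_mul, ← map_mul] at h2
  simpa using h2

/-- Explicit words: the first two clauses give a rotation whose left factor is A⁻¹ and whose right
factor has order 5; the third writes B through A and conjugates of A by roots. -/
theorem root_products :
    root 3 * (root 2)⁻¹ * (root 1 * (root 0)⁻¹) = ofCoords (conj genA) gens_mem.2.2 ∧
    trace ((root 3)⁻¹ * root 2 * ((root 1)⁻¹ * root 0)) = (-1, 1) ∧
    root 1 * ofCoords genA gens_mem.1 * (root 1)⁻¹ * ofCoords genA gens_mem.1 *
      (root 0 * ofCoords genA gens_mem.1 * (root 0)⁻¹) = ofCoords genB gens_mem.2.1 := by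
  simp only [root, ofCoords_inv _ (conj_rootCoords_mem _)]
  refine ⟨?_, ?_, ?_⟩
  · rw [ofCoords_mul _ _ (by decide) (by decide +kernel),
      ofCoords_mul _ _ (by decide) (by decide +kernel),
      ofCoords_mul _ _ (by decide) (by decide +kernel)]
    congr 1
  · rw [ofCoords_mul _ _ (by decide) (by decide +kernel),
      ofCoords_mul _ _ (by decide) (by decide +kernel),
      ofCoords_mul _ _ (by decide) (by decide +kernel), trace_ofCoords]
    decide
  · rw [ofCoords_mul _ _ (by decide) (by decide +kernel),
      ofCoords_mul _ _ (by decide) (by decide +kernel),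
      ofCoords_mul _ _ (by decide) (by decide +kernel),
      ofCoords_mul _ _ (by decide) (by decide +kernel),
      ofCoords_mul _ _ (by decide) (by decide +kernel),
      ofCoords_mul _ _ (by decide) (by decide +kernel)]
    congr 1

theorem genA_pow_six : ofCoords genA gens_mem.1 ^ 6 = 1 := by
  have h1 := toQuat_mul_self (ofCoords genA gens_mem.1)
  have h2 := pow_three_eq_neg_one (q := toQuat (ofCoords genA gens_mem.1)) (by
    rw [h1, trace_ofCoords]; simp [goldenReal, genA])
  have h3 : ofCoords genA gens_mem.1 ^ 3 = negOne := toQuat_injective (by rw [map_pow, h2]; rfl)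
  rw [show 6 = 3 * 2 from rfl, pow_mul, h3, pow_two, negOne_mul_self]

theorem genA_mem_leftSubgroup : ofCoords genA gens_mem.1 ∈ leftSubgroup := by
  obtain ⟨h1, h2, -⟩ := root_products
  -- The fifth power kills the right factor and leaves A⁻⁵ = A on the left, since A⁶ = 1.
  have h := pow_mem (mul_mem (leftRight_root_mem_range 3 2) (leftRight_root_mem_range 1 0)) 5
  rw [← map_mul, ← map_pow, Prod.mk_mul_mk, h1, Prod.pow_mk, pow_five_of_trace (Or.inr h2),
    ← ofCoords_inv gens_mem.1] at h
  have h3 : (ofCoords genA gens_mem.1)⁻¹ ^ 5 = ofCoords genA gens_mem.1 := by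
    rw [inv_pow, inv_eq_iff_mul_eq_one, ← pow_succ, genA_pow_six]
  rwa [h3] at h

theorem leftSubgroup_eq_top : leftSubgroup = ⊤ := by
  refine eq_top_of_gens_mem gens_mem.1 gens_mem.2.1 genA_mem_leftSubgroup ?_
  rw [← root_products.2.2]
  exact mul_mem (mul_mem (conj_mem_leftSubgroup genA_mem_leftSubgroup 1) genA_mem_leftSubgroup)
    (conj_mem_leftSubgroup genA_mem_leftSubgroup 0)

theorem leftRight_left_mem_range (g : binaryIcosahedral) :
    leftRight _ (g, 1) ∈ permRep.range :=
  mem_leftSubgroup.mp (leftSubgroup_eq_top ▸ Subgroup.mem_top g)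

theorem leftRight_right_mem_range (g : binaryIcosahedral) :
    leftRight _ (1, g) ∈ permRep.range := by
  -- The reflection in 1 is u ↦ -u⁻¹, so conjugation by it exchanges left and right multiplications.
  have h : leftRight _ (1, g) =
      reflectionPerm (root 3) * leftRight _ (g, 1) * reflectionPerm (root 3) := by
    ext1 u
    have h2 : negOne⁻¹ = negOne := inv_eq_of_mul_eq_one_left negOne_mul_self
    simp only [Equiv.Perm.mul_apply, reflectionPerm_apply, leftRight_apply, root_three, one_mul,
      mul_one, inv_one, mul_inv_rev, inv_inv, h2]
    rw [mul_assoc u, negOne_comm]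
    simp only [mul_assoc]
    rw [← negOne_comm g⁻¹, ← mul_assoc negOne, negOne_mul_self, one_mul]
  rw [h]
  exact mul_mem (mul_mem (reflectionPerm_mem_range 3) (leftRight_left_mem_range g))
    (reflectionPerm_mem_range 3)

theorem range_toPerm_le : (toPerm binaryIcosahedral).range ≤ permRep.range := by
  rintro _ ⟨c, rfl⟩
  obtain ⟨⟨p, q⟩, rfl⟩ := QuotientGroup.mk_surjective c
  have h := mul_mem (leftRight_left_mem_range p) (leftRight_right_mem_range q)
  rw [← map_mul, Prod.mk_mul_mk, mul_one, one_mul] at h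
  exact h

theorem exists_injective_centralSquare_coxeter :
    ∃ f : CentralSquare binaryIcosahedral →* CoxeterMatrix.H₄.Group, Function.Injective f := by
  let e := MonoidHom.ofInjective permRep_injective
  let g : CentralSquare binaryIcosahedral →* permRep.range :=
    (toPerm binaryIcosahedral).codRestrict permRep.range fun c => range_toPerm_le ⟨c, rfl⟩
  refine ⟨e.symm.toMonoidHom.comp g, e.symm.injective.comp fun a b h => ?_⟩
  exact toPerm_injective (congrArg Subtype.val h)

instance finite_coxeterGroup : Finite CoxeterMatrix.H₄.Group :=
  Finite.of_injective permRep permRep_injective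

theorem minimalDegree_coxeterGroup : minimalDegree CoxeterMatrix.H₄.Group = 120 := by
  refine le_antisymm ?_ ?_
  · rw [← card_binaryIcosahedral]
    exact minimalDegree_le_card permRep permRep_injective
  · obtain ⟨f, hf⟩ := exists_injective_centralSquare_coxeter
    rw [← minimalDegree_centralSquare]
    exact minimalDegree_le_of_injective f hf

/-! ### The root system -/

/-- The linear map sending the simple roots to their realisations as unit quaternions. -/
noncomputable def rootMap : (Fin 4 → ℝ) →ₗ[ℝ] ℍ[ℝ] :=
  Fintype.linearCombination ℝ fun i => toQuat (root i)

theorem rootMap_simpleRoot (i : Fin 4) : rootMap (simpleRoot i) = toQuat (root i) := by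
  simp [rootMap, simpleRoot, Fintype.linearCombination_apply_single]

theorem rootMap_injective : Function.Injective rootMap := by
  rw [← LinearMap.ker_eq_bot, LinearMap.ker_eq_bot']
  intro v hv
  have hφ : φ - 1 ≠ 0 := by
    intro h
    have := Real.goldenRatio_sq
    rw [sub_eq_zero.mp h] at this
    norm_num at this
  rw [rootMap, Fintype.linearCombination_apply, Fin.sum_univ_four] at hv
  simp only [toQuat_root] at hv
  have h1 := congrArg QuaternionAlgebra.re hv
  have h2 := congrArg QuaternionAlgebra.imI hv
  have h3 := congrArg QuaternionAlgebra.imJ hv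
  have h4 := congrArg QuaternionAlgebra.imK hv
  simp [re_toQuaternion, imI_toQuaternion, imJ_toQuaternion, imK_toQuaternion, rootCoords, one,
    goldenReal] at h1 h2 h3 h4
  have e12 : v 1 = v 2 := by
    have : (φ - 1) * (v 2 - v 1) = 0 := by linarith
    exact (sub_eq_zero.mp ((mul_eq_zero.mp this).resolve_left hφ)).symm
  have e1 : v 1 = 0 := by
    have : (φ - 1) * v 1 = 0 := by rw [← e12] at h2; linarith
    exact (mul_eq_zero.mp this).resolve_left hφ
  have e2 : v 2 = 0 := e12 ▸ e1
  rw [e2] at h1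
  rw [e1] at h3
  ext i
  fin_cases i <;> simp <;> linarith

theorem two_mul_cos (i j : Fin 4) :
    2 * Real.cos (Real.pi / (CoxeterMatrix.H₄ i j : ℝ)) =
      -goldenReal (gram (CoxeterMatrix.H₄ i j)) := by
  rcases H₄_cases i j with h | h | h | h <;> rw [h]
  · simp [gram, goldenReal]
  · simp [gram, goldenReal]
  · simp [gram, goldenReal]
  · simp only [gram, goldenReal, Nat.cast_ofNat, Real.cos_pi_div_five, Real.goldenRatio]
    push_cast
    ring

theorem coxeterForm_simpleRoot (i j : Fin 4) :
    coxeterForm CoxeterMatrix.H₄ (simpleRoot i) (simpleRoot j) =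
      -Real.cos (Real.pi / (CoxeterMatrix.H₄ i j : ℝ)) := by
  simp [coxeterForm, simpleRoot, Matrix.toBilin'_single]

theorem rootMap_simpleRootReflection (i : Fin 4) (v : Fin 4 → ℝ) :
    rootMap (simpleRootReflection CoxeterMatrix.H₄ i v) =
      linearRep (coxeterH₄.simple i) (rootMap v) := by
  suffices h : rootMap ∘ₗ simpleRootReflection CoxeterMatrix.H₄ i =
      linearRep (coxeterH₄.simple i) ∘ₗ rootMap from LinearMap.congr_fun h v
  refine (Pi.basisFun ℝ (Fin 4)).ext fun j => ?_
  rw [Pi.basisFun_apply]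
  change rootMap (simpleRootReflection CoxeterMatrix.H₄ i (simpleRoot j)) =
    linearRep (coxeterH₄.simple i) (rootMap (simpleRoot j))
  have h := two_mul_cos j i
  rw [rootMap_simpleRoot, linearRep_simple, reflectionLinear_eq_add, trace_root_mul_inv]
  simp only [simpleRootReflection, LinearMap.sub_apply, LinearMap.id_apply, LinearMap.smul_apply,
    LinearMap.smulRight_apply, map_sub, map_smul, rootMap_simpleRoot, coxeterForm_simpleRoot]
  rw [CoxeterMatrix.H₄.symmetric i j, smul_smul, mul_neg, h, neg_neg]

theorem exists_linearRep_eq {f : Module.End ℝ (Fin 4 → ℝ)}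
    (hf : f ∈ Submonoid.closure (Set.range (simpleRootReflection CoxeterMatrix.H₄))) :
    ∃ w, ∀ v, rootMap (f v) = linearRep w (rootMap v) := by
  induction hf using Submonoid.closure_induction with
  | mem f hf =>
    obtain ⟨i, rfl⟩ := hf
    exact ⟨_, rootMap_simpleRootReflection i⟩
  | one => exact ⟨1, fun v => by simp⟩
  | mul f g _ _ hf hg =>
    obtain ⟨w, hw⟩ := hf
    obtain ⟨w', hw'⟩ := hg
    exact ⟨w * w', fun v => by
      rw [map_mul, Module.End.mul_apply, Module.End.mul_apply, hw, hw']⟩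

theorem exists_mem_closure_eq (w : CoxeterMatrix.H₄.Group) :
    ∃ f ∈ Submonoid.closure (Set.range (simpleRootReflection CoxeterMatrix.H₄)),
      ∀ v, rootMap (f v) = linearRep w (rootMap v) := by
  induction w using coxeterH₄.simple_induction_left with
  | one => exact ⟨1, one_mem _, fun v => by simp⟩
  | mul_simple_left w i ih =>
    obtain ⟨f, hf, h⟩ := ih
    refine ⟨simpleRootReflection _ i * f, mul_mem (Submonoid.subset_closure ⟨i, rfl⟩) hf,
      fun v => ?_⟩
    rw [map_mul, Module.End.mul_apply, Module.End.mul_apply, rootMap_simpleRootReflection, h]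

/-- Reflections preserve the group, so no root falls outside it; left multiplication by u lies in
the image of W(H₄) and carries the simple root 1 to u. -/
theorem rootMap_image_coxeterRoots :
    rootMap '' coxeterRoots CoxeterMatrix.H₄ = Set.range toQuat := by
  ext q
  constructor
  · rintro ⟨_, ⟨f, hf, i, rfl⟩, rfl⟩
    obtain ⟨w, hw⟩ := exists_linearRep_eq hf
    exact ⟨permRep w (root i), by rw [hw, rootMap_simpleRoot, linearRep_toQuat]⟩
  · rintro ⟨u, rfl⟩
    obtain ⟨w, hw⟩ := leftRight_left_mem_range u
    obtain ⟨f, hf, h⟩ := exists_mem_closure_eq w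
    refine ⟨_, ⟨f, hf, 3, rfl⟩, ?_⟩
    rw [h, rootMap_simpleRoot, linearRep_toQuat, hw, root_three]
    simp

theorem ncard_coxeterRoots : (coxeterRoots CoxeterMatrix.H₄).ncard = 120 := by
  rw [← Set.ncard_image_of_injective _ rootMap_injective, rootMap_image_coxeterRoots,
    ← Set.image_univ, Set.ncard_image_of_injective _ toQuat_injective, Set.ncard_univ,
    card_binaryIcosahedral]

end BinaryIcosahedral

theorem mainTheorem4 :
    -- the central square of the binary icosahedral group has a unique minimal normal subgroup,
    -- which has order two
    (∃ N : Subgroup (CentralSquare binaryIcosahedral),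
      IsMinimalNormal N ∧ Nonempty (N ≃* Multiplicative (ZMod 2)) ∧
      ∀ K : Subgroup (CentralSquare binaryIcosahedral), IsMinimalNormal K → K = N) ∧
    -- its faithful permutation representations of minimal degree are transitive
    (∀ f : CentralSquare binaryIcosahedral →*
        Equiv.Perm (Fin (minimalDegree (CentralSquare binaryIcosahedral))),
      Function.Injective f → ∀ x y, ∃ g, f g x = y) ∧
    -- its minimal degree is the least index of a core-free subgroup
    IsLeast {n : ℕ | ∃ L : Subgroup (CentralSquare binaryIcosahedral),
      L.normalCore = ⊥ ∧ L.index = n} (minimalDegree (CentralSquare binaryIcosahedral)) ∧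
    -- the values
    minimalDegree (CentralSquare binaryIcosahedral) = 120 ∧
    minimalDegree CoxeterMatrix.H₄.Group = 120 ∧
    (coxeterRoots CoxeterMatrix.H₄).ncard = 120 :=
  ⟨BinaryIcosahedral.exists_unique_minimal_normal,
    BinaryIcosahedral.transitive_of_injective BinaryIcosahedral.minimalDegree_centralSquare,
    BinaryIcosahedral.minimalDegree_centralSquare ▸ BinaryIcosahedral.isLeast_index_core_free,
    BinaryIcosahedral.minimalDegree_centralSquare, BinaryIcosahedral.minimalDegree_coxeterGroup,
    BinaryIcosahedral.ncard_coxeterRoots⟩
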